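/- **Proposition.** Let $H_1,H_2$ be real separable Hilbert spaces and $\varrho\colon H_1\to H_2$ a bounded linear operator. On a probability space let $$Y_k=\varrho(X_k)+\varepsilon_k,\qquad k\in\mathbb Z,$$ where * $(X_k)_{k\in\mathbb Z}$ is a sequence in $H_1$ with mean zero that is $L^4$-$m$-approximable: $E\|X_k\|^4<\infty$ and $X_k=f(\eta_k,\eta_{k-1},\dots)$ almost surely, for i.i.d. random elements $(\eta_i)_{i\in\mathbb Z}$ of a measurable space and a measurable function $f$, and, with $(\eta_i')$ an independent copy of $(\eta_i)$ and $X_m^{(m)}=f(\eta_m,\dots,\eta_1,\eta_0',\eta_{-1}',\dots)$, we have $\sum_{m\ge1}\big(E\|X_m-X_m^{(m)}\|^4\big)^{1/4}<\infty$; * $(\varepsilon_k)_{k\in\mathbb Z}$ is an i.i.d. sequence in $H_2$ with mean zero and $E\|\varepsilon_k\|^4<\infty$; * for every $k$, $\varepsilon_k$ is independent of the family consisting of $(X_j)_{j\le k}$ and $(\varepsilon_j)_{j<k}$. With $(a\otimes b)(x)=a\langle x,b\rangle$, let $\widehat C_{XX}=\frac1n\sum_{k=1}^nX_k\otimes X_k$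 and $\widehat C_{YX}=\frac1n\sum_{k=1}^nY_k\otimes X_k$, let $\hat\lambda_1\ge\hat\lambda_2\ge\dots\ge0$ be the eigenvalues of $\widehat C_{XX}$, repeated by multiplicity (and continued by $0$ if $\dim H_1<\infty$), and $\hat v_1,\hat v_2,\dots$ corresponding orthonormal eigenvectors, chosen in any way. Let $(m_n)$ be a real sequence with $m_n\to\infty$ and $m_n=o(\sqrt n)$, and let $$T_n=\max\{j\ge1\colon\hat\lambda_j\ge m_n^{-1}\}\quad(\max\emptyset=0),\qquad \hat\varrho_n=\sum_{i=1}^{T_n}\frac1{\hat\lambda_i}\,\widehat C_{YX}\,(\hat v_i\otimes\hat v_i).$$ Then $\hat\varrho_n$ is consistent out of sample and in sample: 1. if $X\stackrel{d}{=}X_1$ and $X$ is independent of the sample $(Y_1,X_1),\dots,(Y_n,X_n)$ for every $n$, then $\|\hat\varrho_n(X)-\varrho(X)\|\to0$ in probability as $n\to\infty$; 2. if, for every $n\ge1$, $K_n$ is uniformly distributed on $\{1,\dots,n\}$ and independent of the sample $(Y_1,X_1),\dots,(Y_n,X_n)$, then $\|\hat\varrho_n(X_{K_n})-\varrho(X_{K_n})\|\to0$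 in probability as $n\to\infty$. -/

import Mathlib

open MeasureTheory ProbabilityTheory Filter Topology Asymptotics InnerProductSpace

noncomputable section

/-- `X` is `L^p`-`m`-approximable: `X k = f (η k, η (k - 1), …)` almost surely for i.i.d. innovations
`η` with values in a measurable space `S` and a measurable `f`, every `X k` is in `L^p`, and
`∑ m, ‖X m - X m ^ (m)‖_p < ∞` over `m ≥ 1`, where `X m ^ (m)` is obtained from `X m` by replacing
the innovations `η 0, η (-1), …` by those of an independent copy of `η`. The independent copy lives
on the second factor of the product space `Ω × Ω`. -/
def IsLpMApproximable {Ω H : Type*} [MeasurableSpace Ω] [NormedAddCommGroup H] [MeasurableSpace H]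
    (S : Type*) [MeasurableSpace S] (p : ENNReal) (X : ℤ → Ω → H) (μ : Measure Ω) : Prop :=
  ∃ (η : ℤ → Ω → S) (f : (ℕ → S) → H),
    (∀ i, Measurable (η i)) ∧ iIndepFun η μ ∧ (∀ i, IdentDistrib (η i) (η 0) μ μ) ∧
    Measurable f ∧
    (∀ k : ℤ, X k =ᵐ[μ] fun ω => f (fun j : ℕ => η (k - j) ω)) ∧
    (∀ k : ℤ, MemLp (X k) p μ) ∧
    ∑' i : ℕ, eLpNorm
      (fun z : Ω × Ω => X ((i : ℤ) + 1) z.1 -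
        f (fun j : ℕ => if j < i + 1 then η ((i : ℤ) + 1 - j) z.1 else η ((i : ℤ) + 1 - j) z.2))
      p (μ.prod μ) < ⊤

/-- The empirical cross-covariance operator `n⁻¹ ∑_{k=1}^n y_k ⊗ x_k`, with `a ⊗ b = a ⟨·, b⟩`. -/
def empCrossCov {G H : Type*} [NormedAddCommGroup G] [InnerProductSpace ℝ G]
    [NormedAddCommGroup H] [InnerProductSpace ℝ H]
    (n : ℕ) (y : ℤ → G) (x : ℤ → H) : H →L[ℝ] G :=
  (n : ℝ)⁻¹ • ∑ k ∈ Finset.Icc (1 : ℤ) n, rankOne ℝ (y k) (x k)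

/-- The empirical covariance operator `n⁻¹ ∑_{k=1}^n x_k ⊗ x_k`. -/
def empCov {H : Type*} [NormedAddCommGroup H] [InnerProductSpace ℝ H]
    (n : ℕ) (x : ℤ → H) : H →L[ℝ] H :=
  empCrossCov n x x

/-- `lam 0 ≥ lam 1 ≥ … ≥ 0` are the ordered eigenvalues of `C`, repeated by multiplicity, and `v i`
are corresponding eigenvectors, orthonormal over the non-zero eigenvalues. No condition beyond
`C (v i) = 0` is put on `v i` when `lam i = 0`, so that a finite-dimensional `H` is covered, where
both sequences are continued by zero. -/
structure IsEigenSystem {H : Type*} [NormedAddCommGroup H] [InnerProductSpace ℝ H]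
    (C : H →L[ℝ] H) (lam : ℕ → ℝ) (v : ℕ → H) : Prop where
  antitone : Antitone lam
  nonneg : ∀ i, 0 ≤ lam i
  apply_eq : ∀ i, C (v i) = lam i • v i
  orthonormal : Orthonormal ℝ (fun i : {i : ℕ // lam i ≠ 0} => v i)
  complete : ∀ x, (∀ i, lam i ≠ 0 → inner ℝ (v i) x = 0) → C x = 0

/-- The truncation level `max {j ≥ 1 : lam_j ≥ m⁻¹}`; the `j`-th eigenvalue is `lam (j - 1)`, and
the maximum of the empty set is `0`. -/
def truncLevel (lam : ℕ → ℝ) (m : ℝ) : ℕ :=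
  sSup {j : ℕ | 1 ≤ j ∧ m⁻¹ ≤ lam (j - 1)}

/-- The single-truncated estimator `∑_{i=1}^T lam_i⁻¹ C_YX (v_i ⊗ v_i)`. -/
def fpcaEstimator {G H : Type*} [NormedAddCommGroup G] [InnerProductSpace ℝ G]
    [NormedAddCommGroup H] [InnerProductSpace ℝ H]
    (CYX : H →L[ℝ] G) (lam : ℕ → ℝ) (v : ℕ → H) (T : ℕ) : H →L[ℝ] G :=
  ∑ i ∈ Finset.range T, (lam i)⁻¹ • CYX ∘L rankOne ℝ (v i) (v i)

section Consistency

variable {Ω H₁ H₂ : Type*} [MeasurableSpace Ω]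
  [NormedAddCommGroup H₁] [NormedSpace ℝ H₁] [MeasurableSpace H₁]
  [NormedAddCommGroup H₂] [NormedSpace ℝ H₂] [MeasurableSpace H₂]

/-- The sample `(Y_1, X_1), …, (Y_n, X_n)`. -/
def sample (Y : ℤ → Ω → H₂) (X : ℤ → Ω → H₁) (n : ℕ) (ω : Ω) : Fin n → H₂ × H₁ :=
  fun i => (Y ((i : ℕ) + 1 : ℤ) ω, X ((i : ℕ) + 1 : ℤ) ω)

/-- Out-of-sample prediction is consistent: `‖ϱ̂_n(X') - ϱ(X')‖ → 0` in probability for every copy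
`X'` of `X_1` that is independent of the samples. -/
def OutOfSampleConsistent (μ : Measure Ω) (Y : ℤ → Ω → H₂) (X : ℤ → Ω → H₁)
    (rho : H₁ →L[ℝ] H₂) (rhoHat : ℕ → Ω → H₁ →L[ℝ] H₂) : Prop :=
  ∀ X' : Ω → H₁, Measurable X' → IdentDistrib X' (X 1) μ μ →
    (∀ n, IndepFun X' (sample Y X n) μ) →
    TendstoInMeasure μ (fun n ω => ‖rhoHat n ω (X' ω) - rho (X' ω)‖) atTop (fun _ => (0 : ℝ))

/-- In-sample prediction is consistent: `‖ϱ̂_n(X_{K_n}) - ϱ(X_{K_n})‖ → 0` in probability whenever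
`K_n` is uniformly distributed on `{1, …, n}` and independent of the sample of size `n`. -/
def InSampleConsistent (μ : Measure Ω) (Y : ℤ → Ω → H₂) (X : ℤ → Ω → H₁)
    (rho : H₁ →L[ℝ] H₂) (rhoHat : ℕ → Ω → H₁ →L[ℝ] H₂) : Prop :=
  ∀ K : ℕ → Ω → ℕ, (∀ n, Measurable (K n)) →
    (∀ n, 1 ≤ n → μ.map (K n) = uniformOn (Set.Icc 1 n)) →
    (∀ n, IndepFun (K n) (sample Y X n) μ) →
    TendstoInMeasure μ
      (fun n ω => ‖rhoHat n ω (X (K n ω) ω) - rho (X (K n ω) ω)‖) atTop (fun _ => (0 : ℝ))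

end Consistency

/-- Eigensystems of empirical covariance operators exist. -/
theorem exists_isEigenSystem_empCov {H : Type*} [NormedAddCommGroup H] [InnerProductSpace ℝ H]
    (n : ℕ) (x : ℤ → H) : ∃ lam v, IsEigenSystem (empCov n x) lam v := by
  have happ : ∀ z, empCov n x z =
      (n : ℝ)⁻¹ • ∑ k ∈ Finset.Icc (1 : ℤ) n, inner ℝ (x k) z • x k := by
    intro z
    simp [empCov, empCrossCov]
  have hsym : ∀ a b, inner ℝ (empCov n x a) b = inner ℝ a (empCov n x b) := by
    intro a b
    simp only [happ, inner_smul_left, inner_smul_right, sum_inner, inner_sum]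
    congr 1
    refine Finset.sum_congr rfl fun k _ => ?_
    rw [real_inner_comm a (x k)]
    simp [mul_comm]
  have hpos : ∀ a, 0 ≤ inner ℝ (empCov n x a) a := by
    intro a
    simp only [happ, inner_smul_left, sum_inner]
    refine mul_nonneg (by simp) (Finset.sum_nonneg fun k _ => ?_)
    simpa using mul_self_nonneg _
  generalize hC : empCov n x = C at *
  let V : Submodule ℝ H := Submodule.span ℝ (x '' (Finset.Icc (1 : ℤ) n : Set ℤ))
  have : FiniteDimensional ℝ V :=
    FiniteDimensional.span_of_finite ℝ ((Finset.finite_toSet _).image x)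
  have hCV : ∀ z, C z ∈ V := by
    intro z
    rw [happ]
    refine V.smul_mem _ (V.sum_mem fun k hk => V.smul_mem _ (Submodule.subset_span ⟨k, hk, rfl⟩))
  let T : V →ₗ[ℝ] V := (C : H →ₗ[ℝ] H).restrict (fun v _ => hCV v)
  have hT : T.IsSymmetric := fun a b => hsym a b
  let d := Module.finrank ℝ V
  let b := hT.eigenvectorBasis (n := d) rfl
  let e := hT.eigenvalues (n := d) rfl
  have hb : ∀ i, C (b i : H) = e i • (b i : H) := fun i =>
    congrArg Subtype.val (hT.apply_eigenvectorBasis rfl i)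
  have he : ∀ i, 0 ≤ e i := by
    intro i
    have h := hpos (b i : H)
    rw [hb, inner_smul_left] at h
    have h1 : inner ℝ (b i : H) (b i : H) = 1 := by
      have := b.orthonormal.1 i
      rw [real_inner_self_eq_norm_sq]
      rw [show ‖(b i : H)‖ = 1 from this]
      norm_num
    rw [h1] at h
    simpa using h
  refine ⟨fun i => if h : i < d then e ⟨i, h⟩ else 0,
    fun i => if h : i < d then (b ⟨i, h⟩ : H) else 0, ?_, ?_, ?_, ?_, ?_⟩
  · intro i j hij
    dsimp only
    split_ifs with h1 h2 h2
    · exact hT.eigenvalues_antitone rfl (by simpa using hij)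
    · omega
    · exact he _
    · exact le_rfl
  · intro i
    split_ifs
    · exact he _
    · exact le_rfl
  · intro i
    split_ifs
    · exact hb _
    · simp
  · have hlt : ∀ i : {i : ℕ // (if h : i < d then e ⟨i, h⟩ else 0) ≠ 0}, (i : ℕ) < d := by
      intro i
      by_contra h
      exact i.2 (by simp [h])
    have := (b.orthonormal.comp_linearIsometry V.subtypeₗᵢ).comp
      (fun i : {i : ℕ // (if h : i < d then e ⟨i, h⟩ else 0) ≠ 0} => (⟨i, hlt i⟩ : Fin d))
      (fun i j hij => Subtype.ext (by simpa using hij))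
    convert this using 1
    funext i
    simp [hlt i]
  · intro z hz
    have h1 : ∀ i, inner ℝ (b i) (⟨C z, hCV z⟩ : V) = 0 := by
      intro i
      change inner ℝ (b i : H) (C z) = 0
      rw [← hsym, hb, inner_smul_left]
      by_cases h0 : e i = 0
      · simp [h0]
      · have := hz i (by simpa using h0)
        simp only [Fin.is_lt, dite_true, Fin.eta] at this
        simp [this]
    have h2 : (⟨C z, hCV z⟩ : V) = 0 := by
      rw [← b.sum_repr' (⟨C z, hCV z⟩ : V)]
      simp [h1]
    exact congrArg Subtype.val h2

end

/-!
Write `Ĉ` for the empirical covariance operator, `P` for the projection onto the leading `T`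
empirical eigenvectors and `R = ∑_{i ≤ T} λ̂_i⁻¹ v̂_i ⊗ v̂_i`. As `Ĉ_YX = ϱ Ĉ + Ĉ_εX` and `Ĉ R = P`,
the prediction error at a point `u` is `-ϱ (u - P u) + Ĉ_εX R u`. Only eigenvalues of size at least
`1 / m` are inverted, so `‖R‖ ≤ m`; only smaller ones are left out, so `‖(I - P) Ĉ‖ ≤ 1 / m`. For
`C = E[X_1 ⊗ X_1]` and any `z`, writing `u = (u - C z) + (C - Ĉ) z + Ĉ z` gives
`‖u - P u‖ ≤ ‖u - C z‖ + ‖(Ĉ - C) z‖ + ‖z‖ / m`, which is `norm_fpcaEstimator_sub_le`. This avoids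
any spacing condition on the eigenvalues and any convergence of eigenvectors.

The three random ingredients are as follows.
* `X_1` lies almost surely in the closed range of `C` (`ae_mem_closure_range_covOp`). Hence, up to
  small probability, finitely many `z` suffice to make `‖X_1 - C z‖` small
  (`exists_measure_preimage_approxRange_compl_le`).
* For fixed `z`, `(Ĉ - C) z → 0` in probability (`IsLpMApproximable.tendsto_measure_empCov_sub`):
  the variables `⟨X_k, z⟩ X_k` are stationary and, by the coupling in `L⁴`-`m`-approximability,
  asymptotically uncorrelated, so their averages converge in mean square.
* `Ĉ_εX = O(n ^ (-1/2))` in probability (`exists_measure_le_norm_empCrossCov_le`): the summands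
  `ε_k ⊗ X_k` are orthogonal in mean for the Hilbert–Schmidt inner product. With `m = o(√n)` this
  makes `m ‖Ĉ_εX‖` vanish.

All this holds on events that do not involve the point of prediction, apart from a set that its law
controls. So consistency holds at any points whose law is dominated by that of `X_1`
(`tendstoInMeasure_prediction`): an independent copy `X'`, and also `X_{K_n}`, whose law is that
of `X_1` by `measure_preimage_random_index_le`.
-/

/-! ### Spectral truncation of a finite-rank operator -/

namespace IsEigenSystem

variable {H : Type*} [NormedAddCommGroup H] [InnerProductSpace ℝ H]
  {C : H →L[ℝ] H} {lam : ℕ → ℝ} {v : ℕ → H}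

theorem orthonormal_finset (h : IsEigenSystem C lam v) {s : Finset ℕ}
    (hs : ∀ i ∈ s, lam i ≠ 0) : Orthonormal ℝ (fun i : s => v i) :=
  h.orthonormal.comp (fun i : s => (⟨i, hs i i.2⟩ : {i : ℕ // lam i ≠ 0}))
    fun i j hij => Subtype.ext (by simpa using hij)

theorem inner_sum_eq (h : IsEigenSystem C lam v) {s : Finset ℕ} (hs : ∀ i ∈ s, lam i ≠ 0)
    (c : ℕ → ℝ) {j : ℕ} (hj : lam j ≠ 0) :
    inner ℝ (v j) (∑ i ∈ s, c i • v i) = if j ∈ s then c j else 0 := by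
  have key : ∀ i ∈ s, inner ℝ (v j) (c i • v i) = if i = j then c i else 0 := by
    intro i hi
    have := orthonormal_iff_ite.1 h.orthonormal ⟨j, hj⟩ ⟨i, hs i hi⟩
    simp only [Subtype.mk.injEq] at this
    rw [inner_smul_right, this]
    by_cases hij : i = j
    · simp [hij]
    · simp [hij, Ne.symm hij]
  rw [inner_sum, Finset.sum_congr rfl key, Finset.sum_ite_eq' s j c]

/-- A diagonal operator in the eigenvectors is bounded by the largest of its coefficients. -/
theorem norm_sum_smul_le (h : IsEigenSystem C lam v) {s : Finset ℕ} (hs : ∀ i ∈ s, lam i ≠ 0)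
    {a : ℕ → ℝ} {M : ℝ} (hM : 0 ≤ M) (ha : ∀ i ∈ s, |a i| ≤ M) (x : H) :
    ‖∑ i ∈ s, (a i * inner ℝ (v i) x) • v i‖ ≤ M * ‖x‖ := by
  have h1 : ‖∑ i ∈ s, (a i * inner ℝ (v i) x) • v i‖ ^ 2
      = ∑ i ∈ s, (a i * inner ℝ (v i) x) ^ 2 := by
    rw [← real_inner_self_eq_norm_sq, sum_inner]
    refine Finset.sum_congr rfl fun i hi => ?_
    rw [inner_smul_left, h.inner_sum_eq hs _ (hs i hi), if_pos hi]
    simp [sq]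
  have h2 : ∑ i ∈ s, (inner ℝ (v i) x) ^ 2 ≤ ‖x‖ ^ 2 := by
    have := (h.orthonormal_finset hs).sum_inner_products_le (s := Finset.univ) x
    rw [← Finset.sum_coe_sort]
    simpa using this
  refine le_of_sq_le_sq ?_ (by positivity)
  rw [h1, mul_pow]
  calc ∑ i ∈ s, (a i * inner ℝ (v i) x) ^ 2 ≤ ∑ i ∈ s, M ^ 2 * (inner ℝ (v i) x) ^ 2 := by
        refine Finset.sum_le_sum fun i hi => ?_
        rw [mul_pow]
        gcongr ?_ * _
        exact sq_le_sq' (by linarith [abs_le.1 (ha i hi)]) (abs_le.1 (ha i hi)).2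
    _ = M ^ 2 * ∑ i ∈ s, (inner ℝ (v i) x) ^ 2 := by rw [Finset.mul_sum]
    _ ≤ _ := by gcongr

theorem norm_sub_sum_le (h : IsEigenSystem C lam v) {s : Finset ℕ} (hs : ∀ i ∈ s, lam i ≠ 0)
    (x : H) : ‖x - ∑ i ∈ s, (inner ℝ (v i) x) • v i‖ ≤ ‖x‖ := by
  set p := ∑ i ∈ s, (inner ℝ (v i) x) • v i with hp
  have h0 : inner ℝ p (x - p) = 0 := by
    rw [hp, sum_inner]
    refine Finset.sum_eq_zero fun i hi => ?_
    rw [inner_smul_left, inner_sub_right, h.inner_sum_eq hs _ (hs i hi), if_pos hi, sub_self,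
      mul_zero]
  have h1 := norm_add_sq_real p (x - p)
  rw [h0, add_sub_cancel] at h1
  exact le_of_sq_le_sq (by nlinarith [sq_nonneg ‖p‖]) (norm_nonneg _)

theorem ne_zero_of_lt (h : IsEigenSystem C lam v) {i j : ℕ} (hj : lam j ≠ 0) (hij : i ≤ j) :
    lam i ≠ 0 :=
  ((lt_of_le_of_ne (h.nonneg j) hj.symm).trans_le (h.antitone hij)).ne'

/-- An operator of finite rank has only finitely many non-zero eigenvalues. -/
theorem exists_eq_zero (h : IsEigenSystem C lam v) [FiniteDimensional ℝ C.range] :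
    ∃ N, lam N = 0 := by
  by_contra! hne
  let w : {i : ℕ // lam i ≠ 0} → C.range := fun i =>
    ⟨v i, ⟨(lam i)⁻¹ • v i, by simp [h.apply_eq, smul_smul, inv_mul_cancel₀ i.2]⟩⟩
  have hli : LinearIndependent ℝ w := by
    refine LinearIndependent.of_comp C.range.subtype ?_
    exact h.orthonormal.linearIndependent
  have : Finite {i : ℕ // lam i ≠ 0} := hli.finite
  have : Infinite {i : ℕ // lam i ≠ 0} :=
    Infinite.of_injective (fun i : ℕ => (⟨i, hne i⟩ : {i : ℕ // lam i ≠ 0}))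
      fun i j hij => by simpa using hij
  exact not_finite {i : ℕ // lam i ≠ 0}

/-- The spectral decomposition of an operator of finite rank, over the first `N` eigenvalues, which
are all the non-zero ones. -/
theorem exists_apply_eq_sum (h : IsEigenSystem C lam v) [FiniteDimensional ℝ C.range] :
    ∃ N, (∀ i, i < N ↔ lam i ≠ 0) ∧
      ∀ x, C x = ∑ i ∈ Finset.range N, (lam i * inner ℝ (v i) x) • v i := by
  classical
  have hN := Nat.find_spec h.exists_eq_zero
  set N := Nat.find h.exists_eq_zero
  have hiff : ∀ i, i < N ↔ lam i ≠ 0 := fun i =>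
    ⟨fun hi => Nat.find_min h.exists_eq_zero hi, fun hi => by
      by_contra hle
      exact h.ne_zero_of_lt hi (not_lt.1 hle) hN⟩
  refine ⟨N, hiff, fun x => ?_⟩
  have hs : ∀ i ∈ Finset.range N, lam i ≠ 0 := fun i hi => (hiff i).1 (Finset.mem_range.1 hi)
  have h0 : C (x - ∑ i ∈ Finset.range N, (inner ℝ (v i) x) • v i) = 0 := by
    refine h.complete _ fun i hi => ?_
    rw [inner_sub_right, h.inner_sum_eq hs _ hi, if_pos (Finset.mem_range.2 ((hiff i).2 hi)),
      sub_self]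
  rw [map_sub, sub_eq_zero] at h0
  rw [h0, map_sum]
  refine Finset.sum_congr rfl fun i _ => ?_
  rw [map_smul, h.apply_eq, smul_smul, mul_comm]

/-- The truncation level separates the eigenvalues that are at least `m⁻¹` from the others. -/
theorem lt_truncLevel_iff (h : IsEigenSystem C lam v) [FiniteDimensional ℝ C.range] {m : ℝ}
    (hm : 0 < m) (i : ℕ) : i < truncLevel lam m ↔ m⁻¹ ≤ lam i := by
  obtain ⟨N, hN⟩ := h.exists_eq_zero
  have hbdd : BddAbove {j : ℕ | 1 ≤ j ∧ m⁻¹ ≤ lam (j - 1)} := by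
    refine ⟨N, fun j hj => ?_⟩
    by_contra hlt
    have := (inv_pos.2 hm).trans_le (hj.2.trans (h.antitone (by omega : N ≤ j - 1)))
    exact this.ne' hN
  constructor
  · intro hi
    have hne : {j : ℕ | 1 ≤ j ∧ m⁻¹ ≤ lam (j - 1)}.Nonempty := by
      by_contra hem
      rw [Set.not_nonempty_iff_eq_empty] at hem
      rw [truncLevel, hem] at hi
      simp at hi
    have hmem := Nat.sSup_mem hne hbdd
    exact hmem.2.trans (h.antitone (Nat.le_sub_one_of_lt hi))
  · intro hi
    exact Nat.lt_of_succ_le (le_csSup hbdd ⟨by omega, by simpa using hi⟩)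

/-- The residual of the projection onto the leading eigenvectors annihilates the range of `C` up to
the truncation threshold. -/
theorem norm_residual_apply_le (h : IsEigenSystem C lam v) [FiniteDimensional ℝ C.range] {m : ℝ}
    (hm : 0 < m) (z : H) :
    ‖C z - ∑ i ∈ Finset.range (truncLevel lam m), (inner ℝ (v i) (C z)) • v i‖ ≤ m⁻¹ * ‖z‖ := by
  obtain ⟨N, hN, hC⟩ := h.exists_apply_eq_sum
  set T := truncLevel lam m with hT
  have hTN : T ≤ N := by
    by_contra! hlt
    have h1 := (h.lt_truncLevel_iff hm N).1 hlt
    exact (lt_irrefl N) ((hN N).2 ((inv_pos.2 hm).trans_le h1).ne')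
  have hs : ∀ i ∈ Finset.range N, lam i ≠ 0 := fun i hi => (hN i).1 (Finset.mem_range.1 hi)
  have hin : ∀ i ∈ Finset.range T, (inner ℝ (v i) (C z)) • v i
      = (lam i * inner ℝ (v i) z) • v i := by
    intro i hi
    have hi' : i ∈ Finset.range N := Finset.range_mono hTN hi
    rw [hC, h.inner_sum_eq hs _ (hs i hi'), if_pos hi']
  rw [Finset.sum_congr rfl hin, hC, ← Finset.sum_sdiff (Finset.range_mono hTN), add_sub_cancel_right]
  refine h.norm_sum_smul_le (fun i hi => hs i (Finset.mem_sdiff.1 hi).1) (by positivity)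
    (fun i hi => ?_) z
  rw [abs_of_nonneg (h.nonneg i)]
  by_contra! hlt
  exact (Finset.mem_sdiff.1 hi).2 (Finset.mem_range.2 ((h.lt_truncLevel_iff hm i).2 hlt.le))

end IsEigenSystem

section Prediction

variable {H₁ H₂ : Type*} [NormedAddCommGroup H₁] [InnerProductSpace ℝ H₁]
  [NormedAddCommGroup H₂] [InnerProductSpace ℝ H₂]

theorem empCrossCov_apply (n : ℕ) (y : ℤ → H₂) (x : ℤ → H₁) (z : H₁) :
    empCrossCov n y x z = (n : ℝ)⁻¹ • ∑ k ∈ Finset.Icc (1 : ℤ) n, inner ℝ (x k) z • y k := by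
  simp [empCrossCov]

theorem empCrossCov_model (n : ℕ) (x : ℤ → H₁) (e y : ℤ → H₂) (rho : H₁ →L[ℝ] H₂)
    (hy : ∀ k, y k = rho (x k) + e k) :
    empCrossCov n y x = rho ∘L empCov n x + empCrossCov n e x := by
  ext z
  simp [empCov, empCrossCov_apply, hy, Finset.sum_add_distrib, map_sum]

instance finiteDimensional_range_empCov (n : ℕ) (x : ℤ → H₁) :
    FiniteDimensional ℝ (empCov n x).range := by
  have : FiniteDimensional ℝ (Submodule.span ℝ (x '' (Finset.Icc (1 : ℤ) n : Set ℤ))) :=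
    FiniteDimensional.span_of_finite ℝ ((Finset.finite_toSet _).image x)
  refine Submodule.finiteDimensional_of_le
    (S₂ := Submodule.span ℝ (x '' (Finset.Icc (1 : ℤ) n : Set ℤ))) ?_
  rintro _ ⟨z, rfl⟩
  change empCrossCov n x x z ∈ _
  rw [empCrossCov_apply]
  exact Submodule.smul_mem _ _ (Submodule.sum_mem _ fun k hk =>
    Submodule.smul_mem _ _ (Submodule.subset_span ⟨k, hk, rfl⟩))

/-- The prediction error at a fixed point `u` splits into a bias, controlled by how well `u` is
approximated by the range of `C` and the empirical covariance by `C`, and a noise term. The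
estimate holds for every operator `C` and every `z`. -/
theorem norm_fpcaEstimator_sub_le (n : ℕ) (x : ℤ → H₁) (e y : ℤ → H₂) (rho : H₁ →L[ℝ] H₂)
    (hy : ∀ k, y k = rho (x k) + e k) {lam : ℕ → ℝ} {v : ℕ → H₁}
    (h : IsEigenSystem (empCov n x) lam v) {m : ℝ} (hm : 0 < m) (C : H₁ →L[ℝ] H₁) (u z : H₁) :
    ‖fpcaEstimator (empCrossCov n y x) lam v (truncLevel lam m) u - rho u‖ ≤
      ‖rho‖ * (‖u - C z‖ + m⁻¹ * ‖z‖ + ‖empCov n x z - C z‖)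
        + m * ‖empCrossCov n e x‖ * ‖u‖ := by
  set T := truncLevel lam m with hT
  set S := empCov n x with hS
  have hle : ∀ i ∈ Finset.range T, m⁻¹ ≤ lam i := fun i hi =>
    (h.lt_truncLevel_iff hm i).1 (Finset.mem_range.1 hi)
  have hs : ∀ i ∈ Finset.range T, lam i ≠ 0 := fun i hi =>
    ((inv_pos.2 hm).trans_le (hle i hi)).ne'
  let P : H₁ → H₁ := fun a => ∑ i ∈ Finset.range T, (inner ℝ (v i) a) • v i
  let R : H₁ := ∑ i ∈ Finset.range T, ((lam i)⁻¹ * inner ℝ (v i) u) • v i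
  have hest : fpcaEstimator (empCrossCov n y x) lam v T u = rho (P u) + empCrossCov n e x R := by
    have hR : S R = P u := by
      simp only [R, P, map_sum, map_smul]
      refine Finset.sum_congr rfl fun i hi => ?_
      rw [h.apply_eq, smul_smul, mul_comm, mul_inv_cancel_left₀ (hs i hi)]
    rw [← hR, ← ContinuousLinearMap.comp_apply, ← add_apply,
      ← empCrossCov_model n x e y rho hy]
    simp [fpcaEstimator, R, smul_smul, map_sum]
  have hRn : ‖R‖ ≤ m * ‖u‖ := by
    refine h.norm_sum_smul_le hs hm.le (fun i hi => ?_) u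
    rw [abs_of_nonneg (inv_nonneg.2 (h.nonneg i))]
    exact inv_le_of_inv_le₀ hm (hle i hi)
  have hres : ‖u - P u‖ ≤ ‖u - C z‖ + m⁻¹ * ‖z‖ + ‖S z - C z‖ := by
    have hlin : u - P u = ((u - C z) - P (u - C z)) + (S z - P (S z))
        - ((S z - C z) - P (S z - C z)) := by
      simp only [P, inner_sub_right, sub_smul, Finset.sum_sub_distrib]
      abel
    rw [hlin]
    refine (norm_sub_le _ _).trans (add_le_add ((norm_add_le _ _).trans (add_le_add ?_ ?_)) ?_)
    · exact h.norm_sub_sum_le hs _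
    · exact h.norm_residual_apply_le hm z
    · exact h.norm_sub_sum_le hs _
  have : rho (P u) + empCrossCov n e x R - rho u = - rho (u - P u) + empCrossCov n e x R := by
    rw [map_sub]; abel
  rw [hest, this]
  refine (norm_add_le _ _).trans (add_le_add ?_ ?_)
  · rw [norm_neg]
    exact (rho.le_opNorm _).trans (by gcongr)
  · refine ((empCrossCov n e x).le_opNorm R).trans ?_
    calc _ ≤ ‖empCrossCov n e x‖ * (m * ‖u‖) := by gcongr
      _ = _ := by ring

/-- The operator norm of a sum of rank-one operators is at most its Hilbert–Schmidt norm. -/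
theorem norm_sum_rankOne_sq_le {ι : Type*} (s : Finset ι) (e : ι → H₂) (x : ι → H₁) :
    ‖∑ k ∈ s, rankOne ℝ (e k) (x k)‖ ^ 2 ≤
      ∑ k ∈ s, ∑ l ∈ s, inner ℝ (x k) (x l) * inner ℝ (e k) (e l) := by
  -- The Hilbert–Schmidt norm is realised as the norm of `τ` in the tensor product.
  let τ : TensorProduct ℝ H₁ H₂ := ∑ k ∈ s, TensorProduct.tmul ℝ (x k) (e k)
  have hτ : ‖τ‖ ^ 2 = ∑ k ∈ s, ∑ l ∈ s, inner ℝ (x k) (x l) * inner ℝ (e k) (e l) := by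
    simp only [← real_inner_self_eq_norm_sq, τ, sum_inner, inner_sum, TensorProduct.inner_tmul]
    exact Finset.sum_comm
  rw [← hτ]
  refine pow_le_pow_left₀ (norm_nonneg _) (ContinuousLinearMap.opNorm_le_bound _ (norm_nonneg _)
    fun u => ?_) 2
  set w := (∑ k ∈ s, rankOne ℝ (e k) (x k)) u with hw
  have h1 : inner ℝ w w = inner ℝ τ (TensorProduct.tmul ℝ u w) := by
    conv_lhs => enter [2]; rw [hw]
    simp [τ, sum_inner, inner_smul_left, TensorProduct.inner_tmul,
      real_inner_comm]
  have h2 : ‖w‖ * ‖w‖ ≤ ‖τ‖ * (‖u‖ * ‖w‖) := by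
    have hcs := real_inner_le_norm τ (TensorProduct.tmul ℝ u w)
    rwa [← h1, TensorProduct.norm_tmul, real_inner_self_eq_norm_mul_norm] at hcs
  rcases eq_or_ne w 0 with h0 | h0
  · rw [h0, norm_zero]; positivity
  · have : 0 < ‖w‖ := norm_pos_iff.2 h0
    nlinarith

end Prediction

/-! ### Inner products of square-integrable variables -/

section SquareIntegrable

variable {α H : Type*} [MeasurableSpace α] [NormedAddCommGroup H] [InnerProductSpace ℝ H]
  {ν : Measure α} {f g : α → H}

theorem integrable_inner_of_memLp_two (hf : MemLp f 2 ν) (hg : MemLp g 2 ν) :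
    Integrable (fun a => inner ℝ (f a) (g a)) ν := by
  refine (L2.integrable_inner (𝕜 := ℝ) (hf.toLp f) (hg.toLp g)).congr ?_
  filter_upwards [hf.coeFn_toLp, hg.coeFn_toLp] with a h1 h2
  rw [h1, h2]

theorem abs_integral_inner_le (hf : MemLp f 2 ν) (hg : MemLp g 2 ν) :
    |∫ a, inner ℝ (f a) (g a) ∂ν| ≤ (eLpNorm f 2 ν).toReal * (eLpNorm g 2 ν).toReal := by
  have h : inner ℝ (hf.toLp f) (hg.toLp g) = ∫ a, inner ℝ (f a) (g a) ∂ν := by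
    rw [L2.inner_def]
    refine integral_congr_ae ?_
    filter_upwards [hf.coeFn_toLp, hg.coeFn_toLp] with a h1 h2
    rw [h1, h2]
  rw [← h, ← Lp.norm_toLp f hf, ← Lp.norm_toLp g hg]
  exact abs_real_inner_le_norm _ _

theorem norm_integral_le_eLpNorm_two [IsProbabilityMeasure ν] (hf : MemLp f 2 ν) :
    ‖∫ a, f a ∂ν‖ ≤ (eLpNorm f 2 ν).toReal := by
  have h1 : eLpNorm f 1 ν ≤ eLpNorm f 2 ν :=
    eLpNorm_le_eLpNorm_of_exponent_le (by norm_num) hf.1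
  refine (norm_integral_le_integral_norm f).trans ?_
  rw [integral_norm_eq_lintegral_enorm hf.1, ← eLpNorm_one_eq_lintegral_enorm]
  exact ENNReal.toReal_mono hf.2.ne h1

end SquareIntegrable

section Independent

variable {Ω H : Type*} [MeasurableSpace Ω] [NormedAddCommGroup H] [InnerProductSpace ℝ H]
  [CompleteSpace H] [MeasurableSpace H] [BorelSpace H] {μ : Measure Ω}

theorem integral_inner_of_indepFun {U V : Ω → H} (hUV : IndepFun U V μ) (hU : Integrable U μ)
    (hV : Integrable V μ) :
    ∫ ω, inner ℝ (U ω) (V ω) ∂μ = inner ℝ (∫ ω, U ω ∂μ) (∫ ω, V ω ∂μ) := by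
  exact hUV.integral_bilin hU hV (innerSL ℝ)

/-- If `V` is close in `L²` to a variable `B` that becomes independent of `U` once the extra
randomness `ω'` is frozen, then `U` and `V` are almost uncorrelated. -/
theorem abs_integral_inner_sub_le_of_coupling [IsProbabilityMeasure μ] {U V : Ω → H}
    {B : Ω × Ω → H} (hU : MemLp U 2 μ) (hV : MemLp V 2 μ) (hB : MemLp B 2 (μ.prod μ))
    (hind : ∀ ω', IndepFun U (fun ω => B (ω, ω')) μ) :
    |∫ ω, inner ℝ (U ω) (V ω) ∂μ - inner ℝ (∫ ω, U ω ∂μ) (∫ ω, V ω ∂μ)| ≤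
      2 * (eLpNorm U 2 μ).toReal *
        (eLpNorm (fun z : Ω × Ω => V z.1 - B z) 2 (μ.prod μ)).toReal := by
  have hfst : MeasurePreserving (Prod.fst : Ω × Ω → Ω) (μ.prod μ) μ := measurePreserving_fst
  have hU1 : MemLp (fun z : Ω × Ω => U z.1) 2 (μ.prod μ) := hU.comp_measurePreserving hfst
  have hV1 : MemLp (fun z : Ω × Ω => V z.1) 2 (μ.prod μ) := hV.comp_measurePreserving hfst
  have hD : MemLp (fun z : Ω × Ω => V z.1 - B z) 2 (μ.prod μ) := hV1.sub hB
  have hBi : Integrable B (μ.prod μ) := hB.integrable (by norm_num)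
  have hVi : Integrable (fun z : Ω × Ω => V z.1) (μ.prod μ) := hV1.integrable (by norm_num)
  have hUi : Integrable U μ := hU.integrable (by norm_num)
  have hUB : ∫ z, inner ℝ (U z.1) (B z) ∂(μ.prod μ)
      = inner ℝ (∫ ω, U ω ∂μ) (∫ z, B z ∂(μ.prod μ)) := by
    rw [integral_prod_symm _ (integrable_inner_of_memLp_two hU1 hB), integral_prod_symm _ hBi,
      ← integral_inner hBi.integral_prod_right]
    refine integral_congr_ae ?_
    filter_upwards [hBi.prod_left_ae] with ω' hω'
    exact integral_inner_of_indepFun (hind ω') hUi hω'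
  have hUV : ∫ ω, inner ℝ (U ω) (V ω) ∂μ = ∫ z : Ω × Ω, inner ℝ (U z.1) (V z.1) ∂(μ.prod μ) := by
    rw [integral_fun_fst (fun ω => inner ℝ (U ω) (V ω))]
    simp
  have hVm : ∫ ω, V ω ∂μ = ∫ z : Ω × Ω, V z.1 ∂(μ.prod μ) := by
    rw [integral_fun_fst V]
    simp
  have hsplit : ∫ ω, inner ℝ (U ω) (V ω) ∂μ - inner ℝ (∫ ω, U ω ∂μ) (∫ ω, V ω ∂μ)
      = ∫ z, inner ℝ (U z.1) (V z.1 - B z) ∂(μ.prod μ)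
        - inner ℝ (∫ ω, U ω ∂μ) (∫ z, (V z.1 - B z) ∂(μ.prod μ)) := by
    simp_rw [inner_sub_right]
    rw [integral_sub (integrable_inner_of_memLp_two hU1 hV1)
      (integrable_inner_of_memLp_two hU1 hB), integral_sub hVi hBi, inner_sub_right, hUV, hVm, hUB]
    ring
  rw [hsplit]
  have hUn : eLpNorm (fun z : Ω × Ω => U z.1) 2 (μ.prod μ) = eLpNorm U 2 μ :=
    eLpNorm_comp_measurePreserving hU.1 hfst
  have h1 := abs_integral_inner_le hU1 hD
  rw [hUn] at h1
  have h2 : |inner ℝ (∫ ω, U ω ∂μ) (∫ z, (V z.1 - B z) ∂(μ.prod μ))| ≤ (eLpNorm U 2 μ).toReal *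
        (eLpNorm (fun z : Ω × Ω => V z.1 - B z) 2 (μ.prod μ)).toReal :=
    (abs_real_inner_le_norm _ _).trans (mul_le_mul (norm_integral_le_eLpNorm_two hU)
      (norm_integral_le_eLpNorm_two hD) (norm_nonneg _) ENNReal.toReal_nonneg)
  refine (abs_sub _ _).trans ?_
  linarith

end Independent

/-! ### A weak law of large numbers under asymptotic uncorrelatedness -/

/-- Every lag occurs at most twice among the pairs with a given first index. -/
theorem sum_natAbs_sub_le {f : ℕ → ℝ} (hf : ∀ h, 0 ≤ f h) (n : ℕ) {k : ℤ}
    (hk : k ∈ Finset.Icc (1 : ℤ) n) :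
    ∑ l ∈ Finset.Icc (1 : ℤ) n, f (l - k).natAbs ≤ 2 * ∑ h ∈ Finset.range n, f h := by
  rw [← Finset.sum_filter_add_sum_filter_not _ (fun l => k ≤ l), two_mul]
  rw [Finset.mem_Icc] at hk
  refine add_le_add ?_ ?_
  · rw [← Finset.sum_image (g := fun l : ℤ => (l - k).natAbs) (f := f)]
    · refine Finset.sum_le_sum_of_subset_of_nonneg (fun h hh => ?_) fun _ _ _ => hf _
      simp only [Finset.mem_image, Finset.mem_filter, Finset.mem_Icc] at hh
      obtain ⟨l, hl, rfl⟩ := hh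
      rw [Finset.mem_range]
      omega
    · intro a ha b hb hab
      simp only [Finset.coe_filter, Set.mem_ofPred_eq] at ha hb hab
      omega
  · rw [← Finset.sum_image (g := fun l : ℤ => (l - k).natAbs) (f := f)]
    · refine Finset.sum_le_sum_of_subset_of_nonneg (fun h hh => ?_) fun _ _ _ => hf _
      simp only [Finset.mem_image, Finset.mem_filter, Finset.mem_Icc] at hh
      obtain ⟨l, hl, rfl⟩ := hh
      rw [Finset.mem_range]
      omega
    · intro a ha b hb hab
      simp only [Finset.coe_filter, Set.mem_ofPred_eq] at ha hb hab
      omega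

/-- The averages of square-integrable variables whose correlations tend to zero with the time lag
converge to the common mean in mean square. -/
theorem tendsto_integral_norm_average_sub_sq {Ω H : Type*} [MeasurableSpace Ω]
    [NormedAddCommGroup H] [InnerProductSpace ℝ H] {μ : Measure Ω} [IsProbabilityMeasure μ]
    {W : ℤ → Ω → H} {w : H} (hW : ∀ k, MemLp (W k) 2 μ) {d : ℕ → ℝ}
    (hd : ∀ k l : ℤ, ∫ ω, inner ℝ (W k ω - w) (W l ω - w) ∂μ = d (l - k).natAbs)
    (hd0 : Tendsto d atTop (𝓝 0)) :
    Tendsto (fun n : ℕ =>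
      ∫ ω, ‖(n : ℝ)⁻¹ • ∑ k ∈ Finset.Icc (1 : ℤ) n, W k ω - w‖ ^ 2 ∂μ) atTop (𝓝 0) := by
  have hV : ∀ k, MemLp (fun ω => W k ω - w) 2 μ := fun k => (hW k).sub (memLp_const w)
  have hces : Tendsto (fun n : ℕ => 2 * ((n : ℝ)⁻¹ * ∑ h ∈ Finset.range n, |d h|)) atTop (𝓝 0) := by
    have := (hd0.abs.cesaro).const_mul 2
    simpa using this
  refine tendsto_of_tendsto_of_tendsto_of_le_of_le' tendsto_const_nhds hces
    (Eventually.of_forall fun n => integral_nonneg fun ω => by positivity) ?_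
  filter_upwards [eventually_ge_atTop 1] with n hn
  have hn0 : (n : ℝ) ≠ 0 := by positivity
  have hexp : ∀ ω, ‖(n : ℝ)⁻¹ • ∑ k ∈ Finset.Icc (1 : ℤ) n, W k ω - w‖ ^ 2 =
      ((n : ℝ)⁻¹ * (n : ℝ)⁻¹) * ∑ k ∈ Finset.Icc (1 : ℤ) n, ∑ l ∈ Finset.Icc (1 : ℤ) n,
        inner ℝ (W k ω - w) (W l ω - w) := by
    intro ω
    have hc : (n : ℝ)⁻¹ • ∑ k ∈ Finset.Icc (1 : ℤ) n, W k ω - w =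
        (n : ℝ)⁻¹ • ∑ k ∈ Finset.Icc (1 : ℤ) n, (W k ω - w) := by
      rw [Finset.sum_sub_distrib, smul_sub, Finset.sum_const, Int.card_Icc]
      simp [← Nat.cast_smul_eq_nsmul ℝ, smul_smul, inv_mul_cancel₀ hn0]
    rw [hc, ← real_inner_self_eq_norm_sq, inner_smul_left, inner_smul_right, sum_inner]
    simp_rw [inner_sum]
    simp [mul_assoc]
  simp_rw [hexp]
  rw [integral_const_mul, integral_finsetSum _ fun k _ => integrable_finsetSum _ fun l _ =>
    integrable_inner_of_memLp_two (hV k) (hV l)]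
  have hin : ∀ k ∈ Finset.Icc (1 : ℤ) n, ∫ ω, ∑ l ∈ Finset.Icc (1 : ℤ) n,
      inner ℝ (W k ω - w) (W l ω - w) ∂μ ≤ 2 * ∑ h ∈ Finset.range n, |d h| := by
    intro k hk
    rw [integral_finsetSum _ fun l _ => integrable_inner_of_memLp_two (hV k) (hV l)]
    refine le_trans (Finset.sum_le_sum fun l _ => ?_)
      (sum_natAbs_sub_le (fun h => abs_nonneg (d h)) n hk)
    rw [hd]
    exact le_abs_self _
  calc _ ≤ ((n : ℝ)⁻¹ * (n : ℝ)⁻¹) *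
        ∑ k ∈ Finset.Icc (1 : ℤ) n, 2 * ∑ h ∈ Finset.range n, |d h| := by
        gcongr with k hk
        exact hin k hk
    _ = _ := by
        rw [Finset.sum_const, Int.card_Icc]
        simp
        field_simp

/-- Mean-square convergence implies convergence in probability. -/
theorem tendsto_measure_le_norm_of_integral_sq {Ω H : Type*} [MeasurableSpace Ω]
    [NormedAddCommGroup H] {μ : Measure Ω}
    {D : ℕ → Ω → H} (hD : ∀ n, MemLp (D n) 2 μ)
    (h : Tendsto (fun n => ∫ ω, ‖D n ω‖ ^ 2 ∂μ) atTop (𝓝 0)) {a : ℝ} (ha : 0 < a) :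
    Tendsto (fun n => μ {ω | a ≤ ‖D n ω‖}) atTop (𝓝 0) := by
  have hlim : Tendsto (fun n => ENNReal.ofReal ((∫ ω, ‖D n ω‖ ^ 2 ∂μ) / a ^ 2)) atTop (𝓝 0) := by
    have := ENNReal.tendsto_ofReal (h.div_const (a ^ 2))
    simpa using this
  refine tendsto_of_tendsto_of_tendsto_of_le_of_le tendsto_const_nhds hlim (fun n => bot_le)
    fun n => ?_
  have hint : Integrable (fun ω => ‖D n ω‖ ^ 2) μ := (hD n).integrable_norm_pow (by norm_num)
  have hmk := mul_meas_ge_le_integral_of_nonneg (μ := μ) (ae_of_all _ fun ω => sq_nonneg ‖D n ω‖)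
    hint (a ^ 2)
  have hset : {ω | a ≤ ‖D n ω‖} ⊆ {ω | a ^ 2 ≤ ‖D n ω‖ ^ 2} := fun ω hω =>
    pow_le_pow_left₀ ha.le hω 2
  refine (measure_mono hset).trans ?_
  have hfin : μ {ω | a ^ 2 ≤ ‖D n ω‖ ^ 2} ≠ ⊤ :=
    (hint.measure_ge_lt_top (by positivity)).ne
  rw [← ENNReal.ofReal_toReal hfin]
  refine ENNReal.ofReal_le_ofReal ?_
  rw [le_div_iff₀ (by positivity), mul_comm]
  exact hmk

/-! ### Stationarity and decoupling of causal processes -/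

section Causal

variable {Ω S H : Type*} [MeasurableSpace Ω] [MeasurableSpace S] [MeasurableSpace H]
  {μ : Measure Ω} {η : ℤ → Ω → S}

theorem identDistrib_shift (hη : ∀ i, Measurable (η i)) (hind : iIndepFun η μ)
    (hid : ∀ i, IdentDistrib (η i) (η 0) μ μ) (k : ℤ) :
    IdentDistrib (fun ω (j : ℤ) => η (k + j) ω) (fun ω j => η j ω) μ μ where
  aemeasurable_fst := (measurable_pi_lambda _ fun j => hη _).aemeasurable
  aemeasurable_snd := (measurable_pi_lambda _ fun j => hη _).aemeasurable
  map_eq := by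
    have hind' : iIndepFun (fun j => η (k + j)) μ :=
      hind.precomp (g := fun j => k + j) (add_right_injective k)
    rw [hind'.map_fun_eq_infinitePi_map (fun j => hη _), hind.map_fun_eq_infinitePi_map hη]
    congr 1
    funext j
    rw [(hid (k + j)).map_eq, (hid j).map_eq]

/-- Pairs from a causal process driven by i.i.d. innovations are stationary. -/
theorem identDistrib_pair {X : ℤ → Ω → H} {f : (ℕ → S) → H} (hη : ∀ i, Measurable (η i))
    (hind : iIndepFun η μ) (hid : ∀ i, IdentDistrib (η i) (η 0) μ μ) (hf : Measurable f)
    (hX : ∀ k : ℤ, X k =ᵐ[μ] fun ω => f (fun j : ℕ => η (k - j) ω)) (k h : ℤ) :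
    IdentDistrib (fun ω => (X k ω, X (k + h) ω)) (fun ω => (X 0 ω, X h ω)) μ μ := by
  let Φ : (ℤ → S) → H × H := fun s => (f (fun j : ℕ => s (-j)), f (fun j : ℕ => s (h - j)))
  have hΦ : Measurable Φ :=
    (hf.comp (measurable_pi_lambda _ fun j => measurable_pi_apply _)).prodMk
      (hf.comp (measurable_pi_lambda _ fun j => measurable_pi_apply _))
  have hΦk : ∀ k : ℤ, (fun ω => (X k ω, X (k + h) ω)) =ᵐ[μ] Φ ∘ fun ω (j : ℤ) => η (k + j) ω := by
    intro k
    filter_upwards [hX k, hX (k + h)] with ω h1 h2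
    simp [Φ, h1, h2, sub_eq_add_neg, add_assoc]
  have hmeas : ∀ k : ℤ, Measurable (Φ ∘ fun ω (j : ℤ) => η (k + j) ω) := fun k =>
    hΦ.comp (measurable_pi_lambda _ fun j => hη _)
  have hk := (IdentDistrib.of_ae_eq (hmeas k).aemeasurable (hΦk k).symm).symm.trans
    ((identDistrib_shift hη hind hid k).comp hΦ)
  have h0 : (fun ω => (X 0 ω, X h ω)) =ᵐ[μ] Φ ∘ fun ω (j : ℤ) => η j ω := by
    simpa using hΦk 0
  have hm0 : Measurable (Φ ∘ fun ω (j : ℤ) => η j ω) := by simpa using hmeas 0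
  exact hk.trans (IdentDistrib.of_ae_eq hm0.aemeasurable h0.symm)

/-- The innovations up to time `0` are independent of those after time `0`. -/
theorem indepFun_past_future [IsProbabilityMeasure μ] (hη : ∀ i, Measurable (η i))
    (hind : iIndepFun η μ) :
    IndepFun (fun ω (j : ℕ) => η (0 - j) ω) (fun ω (j : ℕ) => η (j + 1) ω) μ := by
  refine IndepFun.process_indepFun_process (X := fun (j : ℕ) => η (0 - j))
    (Y := fun (j : ℕ) => η (j + 1)) (fun _ => hη _) (fun _ => hη _) fun I J => ?_
  have hdisj : Disjoint (I.image fun j : ℕ => (0 - j : ℤ)) (J.image fun j : ℕ => (j + 1 : ℤ)) := by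
    rw [Finset.disjoint_left]
    intro a ha hb
    simp only [Finset.mem_image] at ha hb
    obtain ⟨i, _, rfl⟩ := ha
    obtain ⟨j, _, hj⟩ := hb
    omega
  have h := hind.indepFun_finset _ _ hdisj hη
  refine h.comp
    (φ := fun s (i : I) => s ⟨0 - ((i : ℕ) : ℤ), Finset.mem_image_of_mem _ i.2⟩)
    (ψ := fun s (j : J) => s ⟨((j : ℕ) : ℤ) + 1, Finset.mem_image_of_mem _ j.2⟩) ?_ ?_
  · exact measurable_pi_lambda _ fun i => measurable_pi_apply _
  · exact measurable_pi_lambda _ fun i => measurable_pi_apply _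

/-- The value at time `0` is independent of the coupled value at time `i + 1` once the independent
copy of the innovations is frozen, since the latter depends on `η 1, …, η (i + 1)` only. -/
theorem indepFun_coupled [IsProbabilityMeasure μ] {X : ℤ → Ω → H} {f : (ℕ → S) → H}
    (hη : ∀ i, Measurable (η i)) (hind : iIndepFun η μ) (hf : Measurable f)
    (hX : ∀ k : ℤ, X k =ᵐ[μ] fun ω => f (fun j : ℕ => η (k - j) ω)) (i : ℕ) (ω' : Ω) :
    IndepFun (X 0) (fun ω => f (fun j : ℕ =>
      if j < i + 1 then η ((i : ℤ) + 1 - j) ω else η ((i : ℤ) + 1 - j) ω')) μ := by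
  let ψ : (ℕ → S) → H := fun s =>
    f (fun j : ℕ => if j < i + 1 then s (i - j) else η ((i : ℤ) + 1 - j) ω')
  have hψ : Measurable ψ := by
    refine hf.comp (measurable_pi_lambda _ fun j => ?_)
    split_ifs
    · exact measurable_pi_apply _
    · exact measurable_const
  refine ((indepFun_past_future hη hind).comp hf hψ).congr ?_ (Eventually.of_forall fun ω => ?_)
  · exact (hX 0).symm
  · simp only [Function.comp, ψ]
    congr 1
    funext j
    split_ifs with hj
    · congr 1
      omega
    · rfl

end Causal

/-! ### The law of large numbers for the empirical covariance operator -/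

section Quadratic

variable {α H : Type*} [MeasurableSpace α] [NormedAddCommGroup H] [InnerProductSpace ℝ H]
  {ν : Measure α} {f g : α → H}

theorem continuous_inner_smul_self (z : H) : Continuous fun x : H => inner ℝ x z • x := by
  fun_prop

theorem memLp_two_inner_smul_self (hf : MemLp f 4 ν) (z : H) :
    MemLp (fun a => inner ℝ (f a) z • f a) 2 ν := by
  have hm : AEStronglyMeasurable (fun a => inner ℝ (f a) z • f a) ν :=
    (continuous_inner_smul_self z).comp_aestronglyMeasurable hf.1
  rw [memLp_two_iff_integrable_sq_norm hm]
  have hi : Integrable (fun a => ‖f a‖ ^ 4) ν := hf.integrable_norm_pow (by norm_num)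
  refine (hi.const_mul (‖z‖ ^ 2)).mono' (hm.norm.pow 2) (Eventually.of_forall fun a => ?_)
  rw [Real.norm_of_nonneg (by positivity), norm_smul]
  calc (‖inner ℝ (f a) z‖ * ‖f a‖) ^ 2 ≤ (‖f a‖ * ‖z‖ * ‖f a‖) ^ 2 := by
        gcongr
        exact norm_inner_le_norm _ _
    _ = _ := by ring

/-- The map `x ↦ ⟨x, z⟩ x` is locally Lipschitz from `L⁴` to `L²`, by Hölder's inequality. -/
theorem eLpNorm_inner_smul_self_sub_le (hf : MemLp f 4 ν) (hfg : MemLp (fun a => f a - g a) 4 ν)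
    (z : H) :
    eLpNorm (fun a => inner ℝ (f a) z • f a - inner ℝ (g a) z • g a) 2 ν ≤
      ‖z‖ₑ * ((2 * eLpNorm f 4 ν + eLpNorm (fun a => f a - g a) 4 ν) *
        eLpNorm (fun a => f a - g a) 4 ν) := by
  let F : α → ℝ := fun a => 2 * ‖f a‖ + ‖f a - g a‖
  have hpt : ∀ a, ‖inner ℝ (f a) z • f a - inner ℝ (g a) z • g a‖ ≤
      ‖(‖z‖ • (F • fun a => f a - g a)) a‖ := by
    intro a
    have hdec : inner ℝ (f a) z • f a - inner ℝ (g a) z • g a =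
        inner ℝ (f a - g a) z • f a + inner ℝ (g a) z • (f a - g a) := by
      rw [inner_sub_left, sub_smul, smul_sub]; abel
    have hg : ‖g a‖ ≤ ‖f a‖ + ‖f a - g a‖ := by
      have := norm_sub_le (f a) (f a - g a)
      simpa using this
    rw [hdec]
    refine (norm_add_le _ _).trans ?_
    simp only [Pi.smul_apply, Pi.smul_apply', F, norm_smul]
    rw [norm_norm, Real.norm_of_nonneg (by positivity : 0 ≤ 2 * ‖f a‖ + ‖f a - g a‖)]
    have h1 : ‖inner ℝ (f a - g a) z‖ ≤ ‖f a - g a‖ * ‖z‖ := norm_inner_le_norm _ _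
    have h2 : ‖inner ℝ (g a) z‖ ≤ (‖f a‖ + ‖f a - g a‖) * ‖z‖ :=
      (norm_inner_le_norm _ _).trans (by gcongr)
    calc _ ≤ ‖f a - g a‖ * ‖z‖ * ‖f a‖ + (‖f a‖ + ‖f a - g a‖) * ‖z‖ * ‖f a - g a‖ := by gcongr
      _ = _ := by ring
  have hF : AEStronglyMeasurable F ν := (hf.1.norm.const_mul 2).add hfg.1.norm
  have : ENNReal.HolderTriple 4 4 2 := ⟨by
    rw [show (4 : ENNReal) = 2 * 2 by norm_num, ENNReal.mul_inv (by simp) (by simp), ← two_mul,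
      ← mul_assoc, ENNReal.mul_inv_cancel (by simp) (by simp), one_mul]⟩
  refine (eLpNorm_mono hpt).trans ?_
  rw [eLpNorm_const_smul, enorm_norm]
  gcongr
  refine (eLpNorm_smul_le_mul_eLpNorm (p := 4) (q := 4) hfg.1 hF).trans ?_
  gcongr
  refine (eLpNorm_add_le (hf.1.norm.const_mul 2) hfg.1.norm (by norm_num)).trans ?_
  rw [eLpNorm_norm]
  gcongr
  have h2 : (fun a => 2 * ‖f a‖) = (2 : ℝ) • fun a => ‖f a‖ := by ext; simp
  rw [h2, eLpNorm_const_smul, eLpNorm_norm]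
  simp [← ofReal_norm]

end Quadratic

/-- The covariance operator `E[Z ⊗ Z]` of a centred random element `Z`. -/
noncomputable def covOp {Ω H : Type*} [MeasurableSpace Ω] [NormedAddCommGroup H]
    [InnerProductSpace ℝ H] (μ : Measure Ω) (Z : Ω → H) : H →L[ℝ] H :=
  ∫ ω, rankOne ℝ (Z ω) (Z ω) ∂μ

section Covariance

variable {Ω H : Type*} [MeasurableSpace Ω] [NormedAddCommGroup H] [InnerProductSpace ℝ H]
  {μ : Measure Ω} {Z : Ω → H}

theorem integrable_rankOne_self (hZ : MemLp Z 2 μ) :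
    Integrable (fun ω => rankOne ℝ (Z ω) (Z ω)) μ := by
  have hc : Continuous fun x : H => rankOne ℝ x x :=
    (rankOne ℝ).continuous.clm_apply continuous_id
  have hi : Integrable (fun ω => ‖Z ω‖ ^ 2) μ := hZ.integrable_norm_pow (by norm_num)
  refine hi.mono' (hc.comp_aestronglyMeasurable hZ.1) (Eventually.of_forall fun ω => ?_)
  rw [norm_rankOne, sq]

theorem integrable_inner_smul_self (hZ : MemLp Z 2 μ) (z : H) :
    Integrable (fun ω => inner ℝ (Z ω) z • Z ω) μ := by
  simpa using (integrable_rankOne_self hZ).apply_continuousLinearMap z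

theorem covOp_apply (hZ : MemLp Z 2 μ) (z : H) :
    covOp μ Z z = ∫ ω, inner ℝ (Z ω) z • Z ω ∂μ := by
  rw [covOp, ContinuousLinearMap.integral_apply (integrable_rankOne_self hZ)]
  simp

variable [CompleteSpace H]

theorem inner_covOp_apply (hZ : MemLp Z 2 μ) (y z : H) :
    inner ℝ y (covOp μ Z z) = ∫ ω, inner ℝ (Z ω) y * inner ℝ (Z ω) z ∂μ := by
  rw [covOp_apply hZ, ← integral_inner (integrable_inner_smul_self hZ z)]
  refine integral_congr_ae (Eventually.of_forall fun ω => ?_)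
  simp only [inner_smul_right]
  rw [real_inner_comm (Z ω) y, mul_comm]

theorem isSelfAdjoint_covOp (hZ : MemLp Z 2 μ) : IsSelfAdjoint (covOp μ Z) := by
  rw [ContinuousLinearMap.isSelfAdjoint_iff_isSymmetric]
  intro y z
  change inner ℝ (covOp μ Z y) z = inner ℝ y (covOp μ Z z)
  rw [real_inner_comm, inner_covOp_apply hZ, inner_covOp_apply hZ]
  simp_rw [mul_comm]

/-- A random element almost surely lies in the closed range of its covariance operator: it is almost
surely orthogonal to each element of the kernel, hence to a countable dense subset of it. -/
theorem ae_mem_closure_range_covOp [TopologicalSpace.SeparableSpace H] (hZ : MemLp Z 2 μ) :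
    ∀ᵐ ω ∂μ, Z ω ∈ closure (Set.range (covOp μ Z)) := by
  have : SecondCountableTopology H := UniformSpace.secondCountable_of_separable H
  let K : Submodule ℝ H := (covOp μ Z).ker
  have hK : ∀ k : K, ∀ᵐ ω ∂μ, inner ℝ (k : H) (Z ω) = 0 := by
    intro k
    have hk : covOp μ Z k = 0 := k.2
    have hint : Integrable (fun ω => inner ℝ (Z ω) (k : H) * inner ℝ (Z ω) (k : H)) μ := by
      have := (integrable_inner_smul_self hZ (k : H)).const_inner (𝕜 := ℝ) (k : H)
      refine this.congr (Eventually.of_forall fun ω => ?_)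
      simp only [inner_smul_right]
      rw [real_inner_comm (k : H)]
    have h0 := inner_covOp_apply hZ (k : H) (k : H)
    rw [hk, inner_zero_right] at h0
    have h1 := (integral_eq_zero_iff_of_nonneg (fun ω => mul_self_nonneg _) hint).1 h0.symm
    filter_upwards [h1] with ω hω
    rw [real_inner_comm]
    exact mul_self_eq_zero.1 hω
  have hall : ∀ᵐ ω ∂μ, ∀ i, inner ℝ (TopologicalSpace.denseSeq K i : H) (Z ω) = 0 :=
    ae_all_iff.2 fun i => hK _
  filter_upwards [hall] with ω hω
  have hker : Z ω ∈ Kᗮ := by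
    rw [Submodule.mem_orthogonal]
    intro k hk
    have hclosed : IsClosed {k : K | inner ℝ (k : H) (Z ω) = 0} :=
      isClosed_eq (by fun_prop) continuous_const
    have hsub : Set.range (TopologicalSpace.denseSeq K) ⊆ {k : K | inner ℝ (k : H) (Z ω) = 0} := by
      rintro _ ⟨i, rfl⟩
      exact hω i
    have := hclosed.closure_subset_iff.2 hsub
      ((TopologicalSpace.denseRange_denseSeq K) ⟨k, hk⟩)
    exact this
  have hperp : (covOp μ Z).rangeᗮ = K := by
    rw [ContinuousLinearMap.orthogonal_range,
      ContinuousLinearMap.isSelfAdjoint_iff'.1 (isSelfAdjoint_covOp hZ)]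
  rw [← hperp, Submodule.orthogonal_orthogonal_eq_closure] at hker
  have hmem : Z ω ∈ closure ((covOp μ Z).range : Set H) := hker
  rwa [LinearMap.coe_range] at hmem

end Covariance

section Stationary

variable {Ω S H : Type*} [MeasurableSpace Ω] [MeasurableSpace S] [NormedAddCommGroup H]
  [MeasurableSpace H] {μ : Measure Ω} {X : ℤ → Ω → H}

theorem IsLpMApproximable.identDistrib_pair {p : ENNReal} (hX : IsLpMApproximable S p X μ)
    (k h : ℤ) :
    IdentDistrib (fun ω => (X k ω, X (k + h) ω)) (fun ω => (X 0 ω, X h ω)) μ μ := by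
  obtain ⟨η, f, hη, hind, hid, hf, hXf, -, -⟩ := hX
  exact _root_.identDistrib_pair hη hind hid hf hXf k h

theorem IsLpMApproximable.identDistrib {p : ENNReal} (hX : IsLpMApproximable S p X μ) (k l : ℤ) :
    IdentDistrib (X k) (X l) μ μ := by
  have h : ∀ k, IdentDistrib (X k) (X 0) μ μ := fun k =>
    (hX.identDistrib_pair k 0).comp measurable_fst
  exact (h k).trans (h l).symm

theorem IsLpMApproximable.memLp {p : ENNReal} (hX : IsLpMApproximable S p X μ) (k : ℤ) :
    MemLp (X k) p μ := by
  obtain ⟨η, f, -, -, -, -, -, hXp, -⟩ := hX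
  exact hXp k

end Stationary

section LawOfLargeNumbers

variable {Ω S H : Type*} [MeasurableSpace Ω] [MeasurableSpace S]
  [NormedAddCommGroup H] [InnerProductSpace ℝ H] [CompleteSpace H]
  [TopologicalSpace.SeparableSpace H] [MeasurableSpace H] [BorelSpace H]
  {μ : Measure Ω} [IsProbabilityMeasure μ] {X : ℤ → Ω → H}

/-- The quadratic functionals of an `L⁴`-`m`-approximable sequence are asymptotically
uncorrelated. -/
theorem IsLpMApproximable.tendsto_integral_inner (hX : IsLpMApproximable S 4 X μ) (z : H) :
    Tendsto (fun h : ℕ => ∫ ω, inner ℝ (inner ℝ (X 0 ω) z • X 0 ω) (inner ℝ (X h ω) z • X h ω) ∂μ)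
      atTop (𝓝 (inner ℝ (∫ ω, inner ℝ (X 0 ω) z • X 0 ω ∂μ)
        (∫ ω, inner ℝ (X 0 ω) z • X 0 ω ∂μ))) := by
  have : SecondCountableTopology H := UniformSpace.secondCountable_of_separable H
  have hident := hX.identDistrib
  obtain ⟨η, f, hη, hind, hid, hf, hXf, hXp, hsum⟩ := hX
  let q : H → H := fun x => inner ℝ x z • x
  have hq : Measurable q := (continuous_inner_smul_self z).measurable
  let X' : ℕ → Ω × Ω → H := fun i w =>
    f (fun j : ℕ => if j < i + 1 then η ((i : ℤ) + 1 - j) w.1 else η ((i : ℤ) + 1 - j) w.2)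
  have hX'm : ∀ i, Measurable (X' i) := by
    refine fun i => hf.comp (measurable_pi_lambda _ fun j => ?_)
    split_ifs
    · exact (hη _).comp measurable_fst
    · exact (hη _).comp measurable_snd
  let a : ℕ → ENNReal := fun i => eLpNorm (fun w => X ((i : ℤ) + 1) w.1 - X' i w) 4 (μ.prod μ)
  have ha0 : Tendsto a atTop (𝓝 0) := ENNReal.tendsto_atTop_zero_of_tsum_ne_top hsum.ne
  have hafin : ∀ i, a i < ⊤ := fun i => lt_of_le_of_lt (ENNReal.le_tsum i) hsum
  have hfst : MeasurePreserving (Prod.fst : Ω × Ω → Ω) (μ.prod μ) μ := measurePreserving_fst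
  have hX1 : ∀ k, MemLp (fun w : Ω × Ω => X k w.1) 4 (μ.prod μ) := fun k =>
    (hXp k).comp_measurePreserving hfst
  have hdiff : ∀ i : ℕ, MemLp (fun w => X ((i : ℤ) + 1) w.1 - X' i w) 4 (μ.prod μ) := fun i =>
    ⟨(hX1 _).1.sub (hX'm i).aestronglyMeasurable, hafin i⟩
  have hX'p : ∀ i, MemLp (X' i) 4 (μ.prod μ) := fun i => by
    have := (hX1 ((i : ℤ) + 1)).sub (hdiff i)
    refine this.ae_eq (Eventually.of_forall fun w => ?_)
    simp
  let N : ENNReal := eLpNorm (X 0) 4 μ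
  have hNfin : N ≠ ⊤ := (hXp 0).2.ne
  have hN : ∀ k, eLpNorm (fun w : Ω × Ω => X k w.1) 4 (μ.prod μ) = N := fun k => by
    rw [show (fun w : Ω × Ω => X k w.1) = X k ∘ Prod.fst from rfl,
      eLpNorm_comp_measurePreserving (hXp k).1 hfst]
    exact (hident k 0).eLpNorm_eq 4
  let b : ℕ → ENNReal := fun i => ‖z‖ₑ * ((2 * N + a i) * a i)
  have hb0 : Tendsto b atTop (𝓝 0) := by
    have h1 : Tendsto (fun i => 2 * N + a i) atTop (𝓝 (2 * N + 0)) := tendsto_const_nhds.add ha0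
    have h2 := ENNReal.Tendsto.mul h1 (Or.inr ENNReal.zero_ne_top) ha0 (Or.inr (by finiteness))
    have h3 := ENNReal.Tendsto.const_mul (a := ‖z‖ₑ) h2 (Or.inr (by finiteness))
    simpa using h3
  have hbfin : ∀ i, b i ≠ ⊤ := fun i => by
    have := (hafin i).ne
    finiteness
  have hWint : ∀ k, ∫ ω, q (X k ω) ∂μ = ∫ ω, q (X 0 ω) ∂μ := fun k =>
    ((hident k 0).comp hq).integral_eq
  rw [← tendsto_add_atTop_iff_nat 1]
  rw [tendsto_iff_norm_sub_tendsto_zero]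
  have hlim : Tendsto (fun i => 2 * (eLpNorm (fun ω => q (X 0 ω)) 2 μ).toReal * (b i).toReal)
      atTop (𝓝 0) := by
    have := ((ENNReal.tendsto_toReal ENNReal.zero_ne_top).comp hb0).const_mul
      (2 * (eLpNorm (fun ω => q (X 0 ω)) 2 μ).toReal)
    simpa using this
  refine squeeze_zero (fun _ => norm_nonneg _) (fun i => ?_) hlim
  have hcoup := abs_integral_inner_sub_le_of_coupling (μ := μ) (U := fun ω => q (X 0 ω))
    (V := fun ω => q (X ((i : ℤ) + 1) ω)) (B := fun w => q (X' i w))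
    (memLp_two_inner_smul_self (hXp 0) z) (memLp_two_inner_smul_self (hXp _) z)
    (memLp_two_inner_smul_self (hX'p i) z)
    (fun ω' => (indepFun_coupled hη hind hf hXf i ω').comp hq hq)
  rw [hWint ((i : ℤ) + 1)] at hcoup
  rw [Real.norm_eq_abs]
  push_cast
  refine hcoup.trans ?_
  gcongr
  · exact hbfin i
  · have := eLpNorm_inner_smul_self_sub_le (hX1 ((i : ℤ) + 1)) (hdiff i) z
    rwa [hN] at this

/-- The empirical covariance operators converge pointwise in probability. -/
theorem IsLpMApproximable.tendsto_measure_empCov_sub (hX : IsLpMApproximable S 4 X μ) (z : H)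
    {a : ℝ} (ha : 0 < a) :
    Tendsto (fun n => μ {ω | a ≤ ‖empCov n (fun k => X k ω) z - covOp μ (X 1) z‖})
      atTop (𝓝 0) := by
  have : SecondCountableTopology H := UniformSpace.secondCountable_of_separable H
  let q : H → H := fun x => inner ℝ x z • x
  have hq : Measurable q := (continuous_inner_smul_self z).measurable
  have hW : ∀ k, MemLp (fun ω => q (X k ω)) 2 μ := fun k =>
    memLp_two_inner_smul_self (hX.memLp k) z
  set w := ∫ ω, q (X 0 ω) ∂μ with hw
  have hWint : ∀ k, ∫ ω, q (X k ω) ∂μ = w := fun k =>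
    ((hX.identDistrib k 0).comp hq).integral_eq
  have hC : covOp μ (X 1) z = w := by
    rw [covOp_apply ((hX.memLp 1).mono_exponent (by norm_num))]
    exact hWint 1
  let d : ℕ → ℝ := fun h => ∫ ω, inner ℝ (q (X 0 ω)) (q (X h ω)) ∂μ - inner ℝ w w
  have hd0 : Tendsto d atTop (𝓝 0) := by
    have := (hX.tendsto_integral_inner z).sub_const (inner ℝ w w)
    simpa [d, q, hw] using this
  have hle : ∀ (k : ℤ) (h : ℕ), ∫ ω, inner ℝ (q (X k ω)) (q (X (k + h) ω)) ∂μ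
      = ∫ ω, inner ℝ (q (X 0 ω)) (q (X h ω)) ∂μ := fun k h =>
    ((hX.identDistrib_pair k h).comp (u := fun x : H × H => inner ℝ (q x.1) (q x.2))
      ((hq.comp measurable_fst).inner (hq.comp measurable_snd))).integral_eq
  have hcov : ∀ k l : ℤ, ∫ ω, inner ℝ (q (X k ω)) (q (X l ω)) ∂μ
      = ∫ ω, inner ℝ (q (X 0 ω)) (q (X ((l - k).natAbs : ℤ) ω)) ∂μ := by
    intro k l
    rcases le_total k l with hkl | hkl
    · rw [← hle k]
      congr! 5
      omega
    · rw [← hle l]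
      simp_rw [real_inner_comm (q (X l _))]
      congr! 5
      omega
  have hd : ∀ k l : ℤ, ∫ ω, inner ℝ (q (X k ω) - w) (q (X l ω) - w) ∂μ = d (l - k).natAbs := by
    intro k l
    have hk : Integrable (fun ω => q (X k ω)) μ := (hW k).integrable (by norm_num)
    have hl : Integrable (fun ω => q (X l ω)) μ := (hW l).integrable (by norm_num)
    have e1 : ∀ ω, inner ℝ (q (X k ω) - w) (q (X l ω) - w) = inner ℝ (q (X k ω)) (q (X l ω))
        - inner ℝ w (q (X k ω)) - inner ℝ w (q (X l ω)) + inner ℝ w w := by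
      intro ω
      rw [inner_sub_left, inner_sub_right, inner_sub_right, real_inner_comm w (q (X k ω))]
      ring
    have i1 := integrable_inner_of_memLp_two (hW k) (hW l)
    have i2 : Integrable (fun ω => inner ℝ (q (X k ω)) (q (X l ω)) - inner ℝ w (q (X k ω))) μ :=
      i1.sub (hk.const_inner w)
    have i3 : Integrable (fun ω => inner ℝ (q (X k ω)) (q (X l ω)) - inner ℝ w (q (X k ω))
        - inner ℝ w (q (X l ω))) μ := i2.sub (hl.const_inner w)
    simp_rw [e1]
    rw [integral_add i3 (integrable_const _), integral_sub i2 (hl.const_inner w),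
      integral_sub i1 (hk.const_inner w), integral_inner hk, integral_inner hl, hWint, hWint, hcov]
    simp [d]
  have hlln := tendsto_integral_norm_average_sub_sq hW hd hd0
  have hD : ∀ n : ℕ, MemLp (fun ω => (n : ℝ)⁻¹ • ∑ k ∈ Finset.Icc (1 : ℤ) n, q (X k ω) - w) 2 μ :=
    fun n => ((memLp_finsetSum _ fun k _ => hW k).const_smul _).sub (memLp_const w)
  have := tendsto_measure_le_norm_of_integral_sq hD hlln ha
  simpa only [empCov, empCrossCov_apply, hC] using this

end LawOfLargeNumbers

/-! ### The noise operator -/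

section Noise

theorem mul_mul_mul_le_pow_four (a b c d : ℝ) :
    a * b * c * d ≤ a ^ 4 + b ^ 4 + c ^ 4 + d ^ 4 := by
  nlinarith [sq_nonneg (a * b - c * d), sq_nonneg (a ^ 2 - b ^ 2), sq_nonneg (c ^ 2 - d ^ 2),
    sq_nonneg (a * b), sq_nonneg (c * d), sq_nonneg (a ^ 2 + b ^ 2), sq_nonneg (c ^ 2 + d ^ 2)]

variable {Ω H₁ H₂ : Type*} [MeasurableSpace Ω]
  [NormedAddCommGroup H₁] [InnerProductSpace ℝ H₁] [NormedAddCommGroup H₂] [InnerProductSpace ℝ H₂]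
  {μ : Measure Ω} {X : ℤ → Ω → H₁} {ε : ℤ → Ω → H₂}

theorem integrable_inner_mul_inner (hX : ∀ k, MemLp (X k) 4 μ) (hε : ∀ k, MemLp (ε k) 4 μ)
    (k l : ℤ) : Integrable (fun ω => inner ℝ (X k ω) (X l ω) * inner ℝ (ε k ω) (ε l ω)) μ := by
  have hXi : ∀ k, Integrable (fun ω => ‖X k ω‖ ^ 4) μ := fun k =>
    (hX k).integrable_norm_pow (by norm_num)
  have hεi : ∀ k, Integrable (fun ω => ‖ε k ω‖ ^ 4) μ := fun k =>
    (hε k).integrable_norm_pow (by norm_num)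
  refine ((((hXi k).add (hXi l)).add (hεi k)).add (hεi l)).mono'
    (((hX k).1.inner (hX l).1).mul ((hε k).1.inner (hε l).1)) (Eventually.of_forall fun ω => ?_)
  rw [norm_mul]
  refine le_trans ?_ (mul_mul_mul_le_pow_four _ _ _ _)
  rw [mul_assoc (_ * _)]
  exact mul_le_mul (norm_inner_le_norm _ _) (norm_inner_le_norm _ _) (norm_nonneg _)
    (by positivity)

variable [TopologicalSpace.SeparableSpace H₁] [MeasurableSpace H₁] [BorelSpace H₁]
  [CompleteSpace H₂] [TopologicalSpace.SeparableSpace H₂] [MeasurableSpace H₂] [BorelSpace H₂]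
  [IsProbabilityMeasure μ]

/-- The summands of the noise operator at different times are orthogonal in mean, as the later error
is centred and independent of everything else that enters. -/
theorem integral_inner_mul_inner_eq_zero (hXL : ∀ k, MemLp (X k) 4 μ)
    (hεL : ∀ k, MemLp (ε k) 4 μ) (hεmean : ∀ k, ∫ ω, ε k ω ∂μ = 0)
    (hεX : ∀ k : ℤ, IndepFun (ε k)
      (fun ω => ((fun j : {j : ℤ // j ≤ k} => X j ω), (fun j : {j : ℤ // j < k} => ε j ω))) μ)
    {k l : ℤ} (hkl : k ≠ l) :
    ∫ ω, inner ℝ (X k ω) (X l ω) * inner ℝ (ε k ω) (ε l ω) ∂μ = 0 := by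
  wlog hlt : l < k generalizing k l
  · have h := this hkl.symm (lt_of_le_of_ne (not_lt.1 hlt) hkl)
    rw [← h]
    simp_rw [real_inner_comm]
  have : SecondCountableTopology H₁ := UniformSpace.secondCountable_of_separable H₁
  have : SecondCountableTopology H₂ := UniformSpace.secondCountable_of_separable H₂
  let ψ : ({j : ℤ // j ≤ k} → H₁) × ({j : ℤ // j < k} → H₂) → H₂ := fun p =>
    inner ℝ (p.1 ⟨k, le_rfl⟩) (p.1 ⟨l, hlt.le⟩) • p.2 ⟨l, hlt⟩
  have hψ : Measurable ψ := by
    have h1 : ∀ i, Measurable fun p : ({j : ℤ // j ≤ k} → H₁) × ({j : ℤ // j < k} → H₂) => p.1 i :=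
      fun i => (measurable_pi_apply i).comp measurable_fst
    have h2 : ∀ i, Measurable fun p : ({j : ℤ // j ≤ k} → H₁) × ({j : ℤ // j < k} → H₂) => p.2 i :=
      fun i => (measurable_pi_apply i).comp measurable_snd
    exact ((h1 _).inner (h1 _)).smul (h2 _)
  have hind : IndepFun (ε k) (fun ω => inner ℝ (X k ω) (X l ω) • ε l ω) μ :=
    (hεX k).comp measurable_id hψ
  have hU : Integrable (fun ω => inner ℝ (X k ω) (X l ω) • ε l ω) μ := by
    have hXi : ∀ k, Integrable (fun ω => ‖X k ω‖ ^ 4) μ := fun k =>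
      (hXL k).integrable_norm_pow (by norm_num)
    have hεi : ∀ k, Integrable (fun ω => ‖ε k ω‖ ^ 4) μ := fun k =>
      (hεL k).integrable_norm_pow (by norm_num)
    refine ((((hXi k).add (hXi l)).add (hεi l)).add (integrable_const (1 ^ 4))).mono'
      (((hXL k).1.inner (hXL l).1).smul (hεL l).1) (Eventually.of_forall fun ω => ?_)
    refine le_trans ?_ (mul_mul_mul_le_pow_four _ _ _ _)
    rw [norm_smul, mul_one]
    gcongr
    exact norm_inner_le_norm _ _
  have h := integral_inner_of_indepFun hind ((hεL k).integrable (by norm_num)) hU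
  rw [hεmean, inner_zero_left] at h
  simpa only [inner_smul_right] using h

/-- The noise operator is of order `n ^ (-1/2)` in probability. -/
theorem exists_measure_le_norm_empCrossCov_le (hXL : ∀ k, MemLp (X k) 4 μ)
    (hXid : ∀ k, IdentDistrib (X k) (X 0) μ μ)
    (hεL : ∀ k, MemLp (ε k) 4 μ) (hεid : ∀ k, IdentDistrib (ε k) (ε 0) μ μ)
    (hεmean : ∀ k, ∫ ω, ε k ω ∂μ = 0)
    (hεX : ∀ k : ℤ, IndepFun (ε k)
      (fun ω => ((fun j : {j : ℤ // j ≤ k} => X j ω), (fun j : {j : ℤ // j < k} => ε j ω))) μ) :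
    ∃ B : ℝ, ∀ n : ℕ, 1 ≤ n → ∀ a : ℝ, 0 < a →
      μ {ω | a ≤ ‖empCrossCov n (fun k => ε k ω) (fun k => X k ω)‖} ≤
        ENNReal.ofReal (B / (n * a ^ 2)) := by
  have hXi : ∀ k, Integrable (fun ω => ‖X k ω‖ ^ 4) μ := fun k =>
    (hXL k).integrable_norm_pow (by norm_num)
  have hεi : ∀ k, Integrable (fun ω => ‖ε k ω‖ ^ 4) μ := fun k =>
    (hεL k).integrable_norm_pow (by norm_num)
  refine ⟨∫ ω, ‖X 0 ω‖ ^ 4 ∂μ + ∫ ω, ‖ε 0 ω‖ ^ 4 ∂μ, fun n hn a ha => ?_⟩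
  set B := ∫ ω, ‖X 0 ω‖ ^ 4 ∂μ + ∫ ω, ‖ε 0 ω‖ ^ 4 ∂μ with hB
  have hn0 : (0 : ℝ) < n := by exact_mod_cast hn
  let I := Finset.Icc (1 : ℤ) n
  let Q : Ω → ℝ := fun ω => ((n : ℝ)⁻¹) ^ 2 *
    ∑ k ∈ I, ∑ l ∈ I, inner ℝ (X k ω) (X l ω) * inner ℝ (ε k ω) (ε l ω)
  have hle : ∀ ω, ‖empCrossCov n (fun k => ε k ω) (fun k => X k ω)‖ ^ 2 ≤ Q ω := by
    intro ω
    rw [empCrossCov, norm_smul, mul_pow, Real.norm_of_nonneg (by positivity)]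
    exact mul_le_mul_of_nonneg_left (norm_sum_rankOne_sq_le I _ _) (by positivity)
  have hQi : Integrable Q μ := (integrable_finsetSum _ fun k _ => integrable_finsetSum _ fun l _ =>
    integrable_inner_mul_inner hXL hεL k l).const_mul _
  have hdiag : ∀ k, ∫ ω, inner ℝ (X k ω) (X k ω) * inner ℝ (ε k ω) (ε k ω) ∂μ ≤ B := by
    intro k
    have h1 : ∫ ω, ‖X k ω‖ ^ 4 ∂μ = ∫ ω, ‖X 0 ω‖ ^ 4 ∂μ :=
      ((hXid k).comp (measurable_norm.pow_const 4)).integral_eq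
    have h2 : ∫ ω, ‖ε k ω‖ ^ 4 ∂μ = ∫ ω, ‖ε 0 ω‖ ^ 4 ∂μ :=
      ((hεid k).comp (measurable_norm.pow_const 4)).integral_eq
    rw [hB, ← h1, ← h2, ← integral_add (hXi k) (hεi k)]
    refine integral_mono (integrable_inner_mul_inner hXL hεL k k) ((hXi k).add (hεi k)) fun ω => ?_
    simp only [real_inner_self_eq_norm_sq]
    nlinarith [sq_nonneg (‖X k ω‖ ^ 2 - ‖ε k ω‖ ^ 2), sq_nonneg (‖X k ω‖ ^ 2),
      sq_nonneg (‖ε k ω‖ ^ 2)]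
  have hQint : ∫ ω, Q ω ∂μ ≤ B / n := by
    simp only [Q]
    rw [integral_const_mul, integral_finsetSum _ fun k _ => integrable_finsetSum _ fun l _ =>
      integrable_inner_mul_inner hXL hεL k l]
    have hk : ∀ k ∈ I, ∫ ω, ∑ l ∈ I, inner ℝ (X k ω) (X l ω) * inner ℝ (ε k ω) (ε l ω) ∂μ ≤ B := by
      intro k hk
      rw [integral_finsetSum _ fun l _ => integrable_inner_mul_inner hXL hεL k l,
        Finset.sum_eq_single_of_mem k hk fun l _ hl =>
          integral_inner_mul_inner_eq_zero hXL hεL hεmean hεX hl.symm]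
      exact hdiag k
    calc _ ≤ ((n : ℝ)⁻¹) ^ 2 * ∑ k ∈ I, B := by
          gcongr with k hkI
          exact hk k hkI
      _ = _ := by
          rw [Finset.sum_const, Int.card_Icc]
          simp
          field_simp
  have hset : {ω | a ≤ ‖empCrossCov n (fun k => ε k ω) (fun k => X k ω)‖} ⊆ {ω | a ^ 2 ≤ Q ω} :=
    fun ω hω => (pow_le_pow_left₀ ha.le hω 2).trans (hle ω)
  refine (measure_mono hset).trans ?_
  have hmk := mul_meas_ge_le_integral_of_nonneg (μ := μ)
    (ae_of_all _ fun ω => (sq_nonneg _).trans (hle ω)) hQi (a ^ 2)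
  rw [← ENNReal.ofReal_toReal (measure_ne_top μ {ω | a ^ 2 ≤ Q ω})]
  refine ENNReal.ofReal_le_ofReal ?_
  rw [← div_div, le_div_iff₀ (by positivity), mul_comm]
  exact hmk.trans hQint

end Noise

/-! ### Consistency of the predictions -/

section Tightness

variable {Ω H : Type*} [MeasurableSpace Ω] [NormedAddCommGroup H] [InnerProductSpace ℝ H]
  [TopologicalSpace.SeparableSpace H]

/-- The points of norm less than `N` that are `δ`-close to the image under `C` of one of the first
`N` members of a dense sequence. -/
def approxRange (C : H →L[ℝ] H) (δ : ℝ) (N : ℕ) : Set H :=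
  {u | ‖u‖ < N ∧ ∃ i < N, ‖u - C (TopologicalSpace.denseSeq H i)‖ < δ}

theorem isOpen_approxRange (C : H →L[ℝ] H) (δ : ℝ) (N : ℕ) : IsOpen (approxRange C δ N) := by
  have : approxRange C δ N = {u | ‖u‖ < N} ∩
      ⋃ i ∈ Set.Iio N, {u | ‖u - C (TopologicalSpace.denseSeq H i)‖ < δ} := by
    ext u
    simp [approxRange]
  rw [this]
  exact (isOpen_lt continuous_norm continuous_const).inter
    (isOpen_biUnion fun i _ => isOpen_lt (by fun_prop) continuous_const)

variable [MeasurableSpace H] [BorelSpace H] {μ : Measure Ω} [IsProbabilityMeasure μ]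

/-- The sets `approxRange C δ N` exhaust every law that is carried by the closed range of `C`. -/
theorem exists_measure_preimage_approxRange_compl_le {Z : Ω → H} (hZ : Measurable Z)
    {C : H →L[ℝ] H} (hC : ∀ᵐ ω ∂μ, Z ω ∈ closure (Set.range C)) {δ : ℝ} (hδ : 0 < δ)
    {e : ENNReal} (he : 0 < e) : ∃ N, μ (Z ⁻¹' (approxRange C δ N)ᶜ) ≤ e := by
  have hmeas : ∀ N, MeasurableSet (Z ⁻¹' (approxRange C δ N)ᶜ) := fun N =>
    hZ (isOpen_approxRange C δ N).measurableSet.compl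
  have hanti : Antitone fun N => Z ⁻¹' (approxRange C δ N)ᶜ := by
    intro M N hMN
    refine Set.preimage_mono (Set.compl_subset_compl.2 ?_)
    rintro u ⟨hu, i, hi, hui⟩
    exact ⟨hu.trans_le (by exact_mod_cast hMN), i, hi.trans_le hMN, hui⟩
  have hlim := tendsto_measure_iInter_atTop (μ := μ) (fun N => (hmeas N).nullMeasurableSet) hanti
    ⟨0, measure_ne_top _ _⟩
  have hzero : μ (⋂ N, Z ⁻¹' (approxRange C δ N)ᶜ) = 0 := by
    refine measure_eq_zero_iff_ae_notMem.2 ?_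
    filter_upwards [hC] with ω hω hmem
    obtain ⟨_, ⟨z, rfl⟩, hz⟩ := Metric.mem_closure_iff.1 hω (δ / 2) (half_pos hδ)
    obtain ⟨_, ⟨i, rfl⟩, hi⟩ := Metric.mem_closure_iff.1
      ((TopologicalSpace.denseRange_denseSeq H).closure_eq ▸ Set.mem_univ z :
        z ∈ closure (Set.range (TopologicalSpace.denseSeq H)))
      (δ / (2 * (‖C‖ + 1))) (by positivity)
    obtain ⟨M, hM⟩ := exists_nat_gt ‖Z ω‖
    refine Set.mem_iInter.1 hmem (max M (i + 1)) ⟨hM.trans_le (by simp), i, by simp, ?_⟩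
    have h1 : ‖C z - C (TopologicalSpace.denseSeq H i)‖ ≤ δ / 2 := by
      rw [← map_sub]
      rw [dist_eq_norm] at hi
      calc _ ≤ ‖C‖ * ‖z - TopologicalSpace.denseSeq H i‖ := C.le_opNorm _
        _ ≤ (‖C‖ + 1) * (δ / (2 * (‖C‖ + 1))) := by gcongr; linarith
        _ = δ / 2 := by field_simp
    rw [dist_eq_norm] at hz
    calc _ = ‖(Z ω - C z) + (C z - C (TopologicalSpace.denseSeq H i))‖ := by
          rw [sub_add_sub_cancel]
      _ ≤ ‖Z ω - C z‖ + ‖C z - C (TopologicalSpace.denseSeq H i)‖ := norm_add_le _ _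
      _ < δ := by linarith
  rw [hzero] at hlim
  exact (hlim.eventually_le_const he).exists

end Tightness

section Prediction

variable {Ω S H₁ H₂ : Type*} [MeasurableSpace Ω] [MeasurableSpace S]
  [NormedAddCommGroup H₁] [InnerProductSpace ℝ H₁] [CompleteSpace H₁]
  [TopologicalSpace.SeparableSpace H₁] [MeasurableSpace H₁] [BorelSpace H₁]
  [NormedAddCommGroup H₂] [InnerProductSpace ℝ H₂] [CompleteSpace H₂]
  [TopologicalSpace.SeparableSpace H₂] [MeasurableSpace H₂] [BorelSpace H₂]
  {μ : Measure Ω} [IsProbabilityMeasure μ]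

/-- Prediction at a sequence of random points is consistent as soon as the laws of the points are
dominated by the law of `X 1`. The points may depend on the sample in any way. -/
theorem tendstoInMeasure_prediction
    {X : ℤ → Ω → H₁} {ε : ℤ → Ω → H₂} {Y : ℤ → Ω → H₂} {rho : H₁ →L[ℝ] H₂}
    (hXmeas : ∀ k, Measurable (X k)) (hY : ∀ k ω, Y k ω = rho (X k ω) + ε k ω)
    (hX : IsLpMApproximable S 4 X μ)
    (hεident : ∀ k, IdentDistrib (ε k) (ε 0) μ μ)
    (hεL4 : ∀ k, MemLp (ε k) 4 μ) (hεmean : ∀ k, ∫ ω, ε k ω ∂μ = 0)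
    (hεX : ∀ k : ℤ, IndepFun (ε k)
      (fun ω => ((fun j : {j : ℤ // j ≤ k} => X j ω), (fun j : {j : ℤ // j < k} => ε j ω))) μ)
    {m : ℕ → ℝ} (hm : Tendsto m atTop atTop)
    (hmo : m =o[atTop] fun n : ℕ => Real.sqrt n)
    {lam : ℕ → Ω → ℕ → ℝ} {v : ℕ → Ω → ℕ → H₁}
    (hlam : ∀ n ω, IsEigenSystem (empCov n fun k => X k ω) (lam n ω) (v n ω))
    {rhoHat : ℕ → Ω → H₁ →L[ℝ] H₂}
    (hrhoHat : ∀ n ω, rhoHat n ω =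
      fpcaEstimator (empCrossCov n (fun k => Y k ω) (fun k => X k ω)) (lam n ω) (v n ω)
        (truncLevel (lam n ω) (m n)))
    {Z : ℕ → Ω → H₁}
    (hZ : ∀ n, 1 ≤ n → ∀ B, MeasurableSet B → μ (Z n ⁻¹' B) ≤ μ (X 1 ⁻¹' B)) :
    TendstoInMeasure μ (fun n ω => ‖rhoHat n ω (Z n ω) - rho (Z n ω)‖) atTop
      (fun _ => (0 : ℝ)) := by
  rw [tendstoInMeasure_iff_norm]
  intro t ht
  rw [ENNReal.tendsto_nhds_zero]
  intro e he
  set C := covOp μ (X 1)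
  set z := TopologicalSpace.denseSeq H₁
  set δ := t / (4 * (‖rho‖ + 1)) with hδ
  have hδ0 : 0 < δ := by positivity
  have hrange : ∀ᵐ ω ∂μ, X 1 ω ∈ closure (Set.range C) :=
    ae_mem_closure_range_covOp ((hX.memLp 1).mono_exponent (by norm_num))
  obtain ⟨N, hN⟩ := exists_measure_preimage_approxRange_compl_le (hXmeas 1) hrange hδ0
    (ENNReal.half_pos he.ne')
  set b := t / (4 * ((N : ℝ) + 1)) with hb
  have hb0 : 0 < b := by positivity
  -- The noise operator is `O(n ^ (-1/2))`, which beats the factor `m n` from the inverse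
  -- eigenvalues.
  have hnoise : Tendsto (fun n => μ {ω | b ≤ m n *
      ‖empCrossCov n (fun k => ε k ω) (fun k => X k ω)‖}) atTop (𝓝 0) := by
    obtain ⟨B, hB⟩ := exists_measure_le_norm_empCrossCov_le hX.memLp
      (fun k => hX.identDistrib k 0) hεL4 hεident hεmean hεX
    have hratio : Tendsto (fun n : ℕ => ENNReal.ofReal (B / b ^ 2 * (m n / Real.sqrt n) ^ 2))
        atTop (𝓝 0) := by
      have h1 := ((hmo.tendsto_div_nhds_zero).pow 2).const_mul (B / b ^ 2)
      simpa using ENNReal.tendsto_ofReal h1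
    refine tendsto_of_tendsto_of_tendsto_of_le_of_le' tendsto_const_nhds hratio
      (Eventually.of_forall fun _ => bot_le) ?_
    filter_upwards [eventually_ge_atTop 1, hm.eventually_gt_atTop 0] with n hn hmn
    have hn0 : (0 : ℝ) < n := by exact_mod_cast hn
    refine le_trans (measure_mono fun ω hω => ?_)
      ((hB n hn (b / m n) (by positivity)).trans (ENNReal.ofReal_le_ofReal (le_of_eq ?_)))
    · rw [Set.mem_ofPred_eq, div_le_iff₀ hmn, mul_comm]
      exact hω
    · rw [div_pow, div_pow (m n), Real.sq_sqrt hn0.le]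
      field_simp
  have hcov : Tendsto (fun n => ∑ i ∈ Finset.range N,
      μ {ω | δ ≤ ‖empCov n (fun k => X k ω) (z i) - C (z i)‖}) atTop (𝓝 0) := by
    have := tendsto_finsetSum (Finset.range N) fun i _ =>
      hX.tendsto_measure_empCov_sub (z i) hδ0
    simpa using this
  have hsmall : ∀ᶠ n in atTop, (∑ i ∈ Finset.range N,
      μ {ω | δ ≤ ‖empCov n (fun k => X k ω) (z i) - C (z i)‖}) +
      μ {ω | b ≤ m n * ‖empCrossCov n (fun k => ε k ω) (fun k => X k ω)‖} ≤ e / 2 := by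
    have := hcov.add hnoise
    rw [add_zero] at this
    exact this.eventually_le_const (ENNReal.half_pos he.ne')
  have hinv : ∀ᶠ n in atTop, ∀ i ∈ Finset.range N, (m n)⁻¹ * ‖z i‖ < δ := by
    rw [Finset.eventually_all]
    intro i _
    have h1 := (tendsto_inv_atTop_zero.comp hm).mul_const ‖z i‖
    rw [zero_mul] at h1
    exact h1.eventually_lt_const hδ0
  filter_upwards [hsmall, hinv, eventually_ge_atTop 1, hm.eventually_gt_atTop 0]
    with n hn1 hn2 hn3 hmn
  have hsub : {ω | t ≤ ‖‖rhoHat n ω (Z n ω) - rho (Z n ω)‖ - 0‖} ⊆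
      (Z n ⁻¹' (approxRange C δ N)ᶜ) ∪
      ((⋃ i ∈ Finset.range N, {ω | δ ≤ ‖empCov n (fun k => X k ω) (z i) - C (z i)‖}) ∪
      {ω | b ≤ m n * ‖empCrossCov n (fun k => ε k ω) (fun k => X k ω)‖}) := by
    intro ω hω
    by_contra hnot
    simp only [Set.mem_union, not_or, Set.mem_preimage, Set.mem_compl_iff, not_not,
      Set.mem_iUnion, not_exists, Set.mem_ofPred_eq, not_le] at hnot
    obtain ⟨⟨hZN, i, hi, hZi⟩, hcovi, hno⟩ := hnot
    rw [Set.mem_ofPred_eq, sub_zero, norm_norm, hrhoHat] at hω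
    have hbound := norm_fpcaEstimator_sub_le n (fun k => X k ω) (fun k => ε k ω) (fun k => Y k ω)
      rho (fun k => hY k ω) (hlam n ω) hmn C (Z n ω) (z i)
    have hi' := Finset.mem_range.2 hi
    have hbias : ‖rho‖ * (‖Z n ω - C (z i)‖ + (m n)⁻¹ * ‖z i‖ +
        ‖empCov n (fun k => X k ω) (z i) - C (z i)‖) ≤ 3 * t / 4 := by
      calc _ ≤ (‖rho‖ + 1) * (δ + δ + δ) :=
            mul_le_mul (by linarith) (add_le_add (add_le_add hZi.le (hn2 i hi').le)
              (hcovi i hi').le) (by positivity) (by positivity)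
        _ = 3 * t / 4 := by rw [hδ]; field_simp; ring
    have hnoi : m n * ‖empCrossCov n (fun k => ε k ω) (fun k => X k ω)‖ * ‖Z n ω‖ < t / 4 := by
      calc _ ≤ b * N := mul_le_mul hno.le hZN.le (norm_nonneg _) hb0.le
        _ < b * (N + 1) := by gcongr; linarith
        _ = t / 4 := by rw [hb]; field_simp
    linarith
  calc _ ≤ _ := measure_mono hsub
    _ ≤ _ := measure_union_le _ _
    _ ≤ e / 2 + e / 2 := by
        gcongr
        · exact (hZ n hn3 _ (isOpen_approxRange C δ N).measurableSet.compl).trans hN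
        · refine (measure_union_le _ _).trans (le_trans ?_ hn1)
          gcongr
          exact measure_biUnion_finset_le _ _
    _ = e := ENNReal.add_halves e

end Prediction

section InSample

theorem uniformOn_Icc_singleton {n k : ℕ} (hk : k ∈ Finset.Icc 1 n) :
    uniformOn (Set.Icc 1 n) {k} = (n : ENNReal)⁻¹ := by
  have hk' : k ∈ Set.Icc 1 n := by simpa using hk
  have hinter : Set.Icc 1 n ∩ {k} = {k} := Set.inter_eq_right.2 (by simpa using hk)
  rw [uniformOn, cond_apply measurableSet_Icc, hinter, Measure.count_singleton, mul_one,
    ← Finset.coe_Icc, Measure.count_apply_finset]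
  simp

/-- A randomly chosen sample point has the law of `X 1`, for a choice independent of the sample. -/
theorem measure_preimage_random_index_le {Ω H₁ H₂ : Type*} [MeasurableSpace Ω]
    [NormedAddCommGroup H₁] [NormedSpace ℝ H₁] [MeasurableSpace H₁]
    [NormedAddCommGroup H₂] [NormedSpace ℝ H₂] [MeasurableSpace H₂]
    {μ : Measure Ω} {X : ℤ → Ω → H₁} {Y : ℤ → Ω → H₂} {K : Ω → ℕ} {n : ℕ} (hn : 1 ≤ n)
    (hX : ∀ k, IdentDistrib (X k) (X 1) μ μ) (hK : Measurable K)
    (hKlaw : μ.map K = uniformOn (Set.Icc 1 n)) (hind : IndepFun K (sample Y X n) μ)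
    {B : Set H₁} (hB : MeasurableSet B) :
    μ ((fun ω => X (K ω) ω) ⁻¹' B) ≤ μ (X 1 ⁻¹' B) := by
  have hout : μ (K ⁻¹' (Set.Icc 1 n)ᶜ) = 0 := by
    rw [← Measure.map_apply hK measurableSet_Icc.compl, hKlaw, uniformOn,
      cond_apply measurableSet_Icc, Set.inter_compl_self, measure_empty, mul_zero]
  have hterm : ∀ k ∈ Finset.Icc 1 n, μ (K ⁻¹' {k} ∩ X k ⁻¹' B) = (n : ENNReal)⁻¹ * μ (X 1 ⁻¹' B) := by
    intro k hk
    have hk' := Finset.mem_Icc.1 hk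
    let S : Set (Fin n → H₂ × H₁) := (fun s => (s ⟨k - 1, by omega⟩).2) ⁻¹' B
    have hS : MeasurableSet S := (measurable_snd.comp (measurable_pi_apply _)) hB
    have hpre : sample Y X n ⁻¹' S = X k ⁻¹' B := by
      have hcast : ((k - 1 : ℕ) : ℤ) + 1 = k := by omega
      ext ω
      simp [S, sample, hcast]
    rw [← hpre, hind.measure_inter_preimage_eq_mul _ _ (measurableSet_singleton k) hS, hpre,
      ← Measure.map_apply hK (measurableSet_singleton k), hKlaw, uniformOn_Icc_singleton hk,
      (hX k).measure_mem_eq hB]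
  have hsub : (fun ω => X (K ω) ω) ⁻¹' B ⊆ K ⁻¹' (Set.Icc 1 n)ᶜ ∪
      ⋃ k ∈ Finset.Icc 1 n, (K ⁻¹' {k} ∩ X k ⁻¹' B) := by
    intro ω hω
    by_cases h : K ω ∈ Set.Icc 1 n
    · exact Or.inr (Set.mem_biUnion (x := K ω) (by simpa using h) ⟨rfl, hω⟩)
    · exact Or.inl h
  calc _ ≤ _ := measure_mono hsub
    _ ≤ _ := measure_union_le _ _
    _ ≤ 0 + ∑ k ∈ Finset.Icc 1 n, μ (K ⁻¹' {k} ∩ X k ⁻¹' B) := by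
        rw [hout]
        gcongr
        exact measure_biUnion_finset_le _ _
    _ = μ (X 1 ⁻¹' B) := by
        rw [Finset.sum_congr rfl hterm, Finset.sum_const, Nat.card_Icc, zero_add,
          Nat.add_sub_cancel, nsmul_eq_mul, ← mul_assoc,
          ENNReal.mul_inv_cancel (by simp; omega) (by simp), one_mul]

end InSample

theorem propositionp
    {Ω S H₁ H₂ : Type*} [MeasurableSpace Ω] [MeasurableSpace S]
    [NormedAddCommGroup H₁] [InnerProductSpace ℝ H₁] [CompleteSpace H₁]
    [TopologicalSpace.SeparableSpace H₁] [MeasurableSpace H₁] [BorelSpace H₁]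
    [NormedAddCommGroup H₂] [InnerProductSpace ℝ H₂] [CompleteSpace H₂]
    [TopologicalSpace.SeparableSpace H₂] [MeasurableSpace H₂] [BorelSpace H₂]
    (μ : Measure Ω) [IsProbabilityMeasure μ]
    -- the regression model
    (X : ℤ → Ω → H₁) (ε : ℤ → Ω → H₂) (Y : ℤ → Ω → H₂) (rho : H₁ →L[ℝ] H₂)
    (hXmeas : ∀ k, Measurable (X k)) (hεmeas : ∀ k, Measurable (ε k))
    (hY : ∀ k ω, Y k ω = rho (X k ω) + ε k ω)
    -- the covariates
    (hXmean : ∀ k, ∫ ω, X k ω ∂μ = 0)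
    (hX : IsLpMApproximable S 4 X μ)
    -- the errors
    (hεindep : iIndepFun ε μ) (hεident : ∀ k, IdentDistrib (ε k) (ε 0) μ μ)
    (hεL4 : ∀ k, MemLp (ε k) 4 μ) (hεmean : ∀ k, ∫ ω, ε k ω ∂μ = 0)
    -- each error is independent of the present and past covariates and of the past errors
    (hεX : ∀ k : ℤ, IndepFun (ε k)
      (fun ω => ((fun j : {j : ℤ // j ≤ k} => X j ω), (fun j : {j : ℤ // j < k} => ε j ω))) μ)
    -- the tuning parameter
    (m : ℕ → ℝ) (hm : Tendsto m atTop atTop)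
    (hmo : m =o[atTop] fun n : ℕ => Real.sqrt n)
    -- any choice of eigenvalues and eigenvectors of the empirical covariance operators
    (lam : ℕ → Ω → ℕ → ℝ) (v : ℕ → Ω → ℕ → H₁)
    (hlam : ∀ n ω, IsEigenSystem (empCov n fun k => X k ω) (lam n ω) (v n ω))
    -- the estimator
    (rhoHat : ℕ → Ω → H₁ →L[ℝ] H₂)
    (hrhoHat : ∀ n ω, rhoHat n ω =
      fpcaEstimator (empCrossCov n (fun k => Y k ω) (fun k => X k ω)) (lam n ω) (v n ω)
        (truncLevel (lam n ω) (m n))) :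
    OutOfSampleConsistent μ Y X rho rhoHat ∧ InSampleConsistent μ Y X rho rhoHat := by
  refine ⟨fun X' _ hX'law _ => ?_, fun K hK hKlaw hKind => ?_⟩
  · exact tendstoInMeasure_prediction (Z := fun _ => X') hXmeas hY hX hεident hεL4 hεmean hεX hm hmo
      hlam hrhoHat fun n _ B hB => (hX'law.measure_mem_eq hB).le
  · exact tendstoInMeasure_prediction (Z := fun n ω => X (K n ω) ω) hXmeas hY hX hεident hεL4 hεmean
      hεX hm hmo hlam hrhoHat fun n hn B hB =>
        measure_preimage_random_index_le hn (fun k => hX.identDistrib k 1) (hK n) (hKlaw n hn)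
          (hKind n) hB
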